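/- Let $E_0,E_1$ be complex Banach spaces with $E_1$ densely and continuously embedded in $E_0$, write $E=(E_0,E_1)$, and let $1<p<\infty$. For an interval $J=[0,T)$ with $0<T<\infty$, or $J=[0,\infty)$, let $Y^p(J)=L^p(J\to E_1)\cap W^{1,p}(J\to E_0)$; its elements are identified with their continuous representatives $J\to E_0$. Let $E_{1-1/p,p}=\{u(0):u\in Y^p([0,\infty))\}$ be the trace space, with the norm $\|x\|_{E_{1-1/p,p}}=\inf\{\|u\|_{L^p([0,\infty)\to E_1)}+\|u'\|_{L^p([0,\infty)\to E_0)}:u\in Y^p([0,\infty)),\ u(0)=x\}$. For $B\in\mathcal L(E_1\to E_0)$, $g\in L^p((0,T)\to E_0)$ and $u_0\in E_{1-1/p,p}$, a strict solution on $[0,T)$ of $$\frac{du}{dt}-Bu(t)=g(t)\quad\text{for a.e. }t\in(0,T),\qquad u(0)=u_0, \tag{1}$$ is a function $u\in Y^p([0,T))$ that satisfies (1). The operator $B$ has the maximal $L^p$-regularity property on $(0,T)$ if $B$, as an operator on $E_0$ with domain $E_1$, generates a strongly continuous holomorphic semigroup on $E_0$, if (1) has a unique strict solution $u$ for all such $g$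 and $u_0$, and if there is a constant $M>0$, independent of $g$ and $u_0$, such that $$\int_0^T\Big\|\frac{du}{dt}\Big\|_{E_0}^p\,dt+\int_0^T\|Bu(t)\|_{E_0}^p\,dt\le M\Big(\|u_0\|_{E_{1-1/p,p}}^p+\int_0^T\|g(t)\|_{E_0}^p\,dt\Big). \tag{2}$$ We write $B\in\mathrm{MR}_p(E)$ if this holds for some $T=T_0\in(0,\infty)$. **Lemma.** Let $B\in\mathrm{MR}_p(E)$. Then there is a number $\delta_0\in(0,1)$ such that the following holds for all $\delta\in(0,\delta_0]$, all $C_\delta\in[0,\infty)$ and all $T\in(0,\infty)$. There is a constant $\tilde M=\tilde M(p,E,B,\delta,C_\delta,T)>0$ such that every $A\in\mathcal L(E_1\to E_0)$ with $$\|Au\|_{E_0}\le\delta\,\|Bu\|_{E_0}+C_\delta\,\|u\|_{E_0}\qquad\text{for all }u\in E_1$$ has the following two properties: the operator $B+A$ has the maximal $L^p$-regularity property on $(0,T)$; and for all $u_0\in E_{1-1/p,p}$ and $g\in L^p((0,T)\to E_0)$, the unique strict solution $v$ on $[0,T)$ of $\frac{dv}{dt}-(B+A)v=g$, $v(0)=u_0$,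 satisfies $$\int_0^T\Big\|\frac{dv}{dt}\Big\|_{E_0}^p\,dt+\int_0^T\|(B+A)v(t)\|_{E_0}^p\,dt\le\tilde M\Big(\|u_0\|_{E_{1-1/p,p}}^p+\int_0^T\|g(t)\|_{E_0}^p\,dt\Big).$$ -/

import Mathlib

open Set Filter Topology MeasureTheory
open scoped ENNReal

noncomputable section

/-! Throughout, a densely and continuously embedded Banach couple `E₁ ↪ E₀` is given by its
embedding `ι : E₁ →L[ℂ] E₀` (injective, with dense range), and an operator of `𝓛(E₁ → E₀)` is a
`B : E₁ →L[ℂ] E₀`. -/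

/-- The open sector of half-angle `θ` around the positive real half-line. -/
def openSector (θ : ℝ) : Set ℂ := {z | z ≠ 0 ∧ |z.arg| < θ}

/-- `S` is a holomorphic (analytic) semigroup of bounded linear operators in the sector of
half-angle `θ`, strongly continuous at `0`. Only the values of `S` on the sector and at `0`
matter. -/
structure IsHolomorphicSemigroup {E₀ : Type*} [NormedAddCommGroup E₀] [NormedSpace ℂ E₀]
    (θ : ℝ) (S : ℂ → E₀ →L[ℂ] E₀) : Prop where
  map_zero : S 0 = ContinuousLinearMap.id ℂ E₀
  map_add : ∀ z ∈ openSector θ, ∀ w ∈ openSector θ, S (z + w) = (S z).comp (S w)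
  holomorphic : DifferentiableOn ℂ S (openSector θ)
  strongly_continuous : ∀ x : E₀, Tendsto (fun z => S z x) (𝓝[openSector θ] 0) (𝓝 x)

/-- `B`, viewed as an unbounded operator on `E₀` with domain (the image of) `E₁`, is the
infinitesimal generator of the one-parameter family `S t`, `t ≥ 0`: the right derivative of
`t ↦ S t x` at `0` exists exactly for `x` in the domain, and then it is `B x`. -/
def IsInfinitesimalGenerator {E₀ E₁ : Type*} [NormedAddCommGroup E₀] [NormedSpace ℂ E₀]
    [NormedAddCommGroup E₁] [NormedSpace ℂ E₁]
    (ι B : E₁ →L[ℂ] E₀) (S : ℝ → E₀ →L[ℂ] E₀) : Prop :=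
  ∀ x y : E₀, Tendsto (fun h : ℝ => h⁻¹ • (S h x - x)) (𝓝[>] 0) (𝓝 y) ↔
    ∃ w : E₁, ι w = x ∧ B w = y

/-- The class `Hol(E)`: operators with domain `E₁` generating a strongly continuous holomorphic
semigroup on `E₀`. -/
def IsHol {E₀ E₁ : Type*} [NormedAddCommGroup E₀] [NormedSpace ℂ E₀]
    [NormedAddCommGroup E₁] [NormedSpace ℂ E₁] (ι B : E₁ →L[ℂ] E₀) : Prop :=
  ∃ θ : ℝ, 0 < θ ∧ θ ≤ Real.pi / 2 ∧ ∃ S : ℂ → E₀ →L[ℂ] E₀,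
    IsHolomorphicSemigroup θ S ∧ IsInfinitesimalGenerator ι B (fun t : ℝ => S (t : ℂ))

/-- `u : J → E₀` belongs to the abstract Sobolev space `L^p(J → E₁) ∩ W^{1,p}(J → E₀)`, for an
interval `J` (used with `J = [0, ∞)` and `J = [0, T)`). Here `U` is the `E₁`-valued function
which equals `u` almost everywhere, and `u'` is the derivative of `u`: `u` itself is the
continuous representative, that is, the indefinite integral of `u' ∈ L^p(J → E₀)`. -/
structure IsAbstractSobolev {E₀ E₁ : Type*} [NormedAddCommGroup E₀] [NormedSpace ℂ E₀]
    [NormedAddCommGroup E₁] [NormedSpace ℂ E₁] (ι : E₁ →L[ℂ] E₀) (p : ℝ) (J : Set ℝ)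
    (u : ℝ → E₀) (U : ℝ → E₁) (u' : ℝ → E₀) : Prop where
  memLp : MemLp U (ENNReal.ofReal p) (volume.restrict J)
  ae_eq : ∀ᵐ t ∂(volume.restrict J), ι (U t) = u t
  memLp_deriv : MemLp u' (ENNReal.ofReal p) (volume.restrict J)
  sub_eq_integral : ∀ t₁ ∈ J, ∀ t₂ ∈ J, t₁ ≤ t₂ → u t₂ - u t₁ = ∫ s in t₁..t₂, u' s

/-- The real interpolation (trace) space `E_{1 - 1/p, p}`: the initial values of functions in
`L^p(ℝ₊ → E₁) ∩ W^{1,p}(ℝ₊ → E₀)`. -/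
def traceSpace {E₀ E₁ : Type*} [NormedAddCommGroup E₀] [NormedSpace ℂ E₀]
    [NormedAddCommGroup E₁] [NormedSpace ℂ E₁] (ι : E₁ →L[ℂ] E₀) (p : ℝ) : Set E₀ :=
  {x | ∃ (u : ℝ → E₀) (U : ℝ → E₁) (u' : ℝ → E₀),
    IsAbstractSobolev ι p (Ici 0) u U u' ∧ u 0 = x}

/-- The trace norm on `E_{1 - 1/p, p}`, with values in `[0, ∞]`: the infimum of
`‖u‖_{L^p(ℝ₊ → E₁)} + ‖u'‖_{L^p(ℝ₊ → E₀)}` over all `u` with `u(0) = x` (it is `∞` exactly off the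
trace space). -/
def traceNorm {E₀ E₁ : Type*} [NormedAddCommGroup E₀] [NormedSpace ℂ E₀]
    [NormedAddCommGroup E₁] [NormedSpace ℂ E₁] (ι : E₁ →L[ℂ] E₀) (p : ℝ) (x : E₀) : ℝ≥0∞ :=
  ⨅ (u : ℝ → E₀) (U : ℝ → E₁) (u' : ℝ → E₀)
    (_ : IsAbstractSobolev ι p (Ici 0) u U u' ∧ u 0 = x),
    eLpNorm U (ENNReal.ofReal p) (volume.restrict (Ici 0)) +
      eLpNorm u' (ENNReal.ofReal p) (volume.restrict (Ici 0))

/-- `u` (with `E₁`-valued version `U` and derivative `u'`) is a strict solution on `[0, T)` of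
`du/dt - B u = g`, `u(0) = u₀`. -/
structure IsStrictSolution {E₀ E₁ : Type*} [NormedAddCommGroup E₀] [NormedSpace ℂ E₀]
    [NormedAddCommGroup E₁] [NormedSpace ℂ E₁] (ι : E₁ →L[ℂ] E₀) (p T : ℝ) (B : E₁ →L[ℂ] E₀)
    (g : ℝ → E₀) (u₀ : E₀) (u : ℝ → E₀) (U : ℝ → E₁) (u' : ℝ → E₀) : Prop where
  sobolev : IsAbstractSobolev ι p (Ico 0 T) u U u'
  initial : u 0 = u₀
  equation : ∀ᵐ t ∂(volume.restrict (Ico 0 T)), u' t - B (U t) = g t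

/-- The maximal regularity estimate on `(0, T)` with constant `M`:
`∫ ‖du/dt‖^p + ∫ ‖B u‖^p ≤ M (‖u₀‖^p + ∫ ‖g‖^p)` for every strict solution, where `u₀` is measured
in the trace norm. -/
def MaxRegEstimate {E₀ E₁ : Type*} [NormedAddCommGroup E₀] [NormedSpace ℂ E₀]
    [NormedAddCommGroup E₁] [NormedSpace ℂ E₁] (ι : E₁ →L[ℂ] E₀) (p T : ℝ) (B : E₁ →L[ℂ] E₀)
    (M : ℝ) : Prop :=
  ∀ u₀ ∈ traceSpace ι p, ∀ g : ℝ → E₀,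
    MemLp g (ENNReal.ofReal p) (volume.restrict (Ico 0 T)) →
    ∀ (u : ℝ → E₀) (U : ℝ → E₁) (u' : ℝ → E₀), IsStrictSolution ι p T B g u₀ u U u' →
      (∫⁻ t in Ico 0 T, ‖u' t‖ₑ ^ p) + (∫⁻ t in Ico 0 T, ‖B (U t)‖ₑ ^ p) ≤
        ENNReal.ofReal M * (traceNorm ι p u₀ ^ p + ∫⁻ t in Ico 0 T, ‖g t‖ₑ ^ p)

/-- The class `MR_p(E)` of operators with the maximal `L^p`-regularity property, on the time
interval `(0, T)`. -/
structure IsMaxReg {E₀ E₁ : Type*} [NormedAddCommGroup E₀] [NormedSpace ℂ E₀]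
    [NormedAddCommGroup E₁] [NormedSpace ℂ E₁] (ι : E₁ →L[ℂ] E₀) (p T : ℝ)
    (B : E₁ →L[ℂ] E₀) : Prop where
  hol : IsHol ι B
  existsUnique : ∀ u₀ ∈ traceSpace ι p, ∀ g : ℝ → E₀,
    MemLp g (ENNReal.ofReal p) (volume.restrict (Ico 0 T)) →
    ∃ (u : ℝ → E₀) (U : ℝ → E₁) (u' : ℝ → E₀), IsStrictSolution ι p T B g u₀ u U u' ∧
      ∀ (w : ℝ → E₀) (W : ℝ → E₁) (w' : ℝ → E₀), IsStrictSolution ι p T B g u₀ w W w' →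
        EqOn w u (Ico 0 T)
  estimate : ∃ M : ℝ, 0 < M ∧ MaxRegEstimate ι p T B M

end

/-! ### Affine changes of variable -/

section Affine

variable {F : Type*} [NormedAddCommGroup F] {h a : ℝ} {I J : Set ℝ}

/-! Everything is reduced to the problem u' - Bu = g, u(0) = 0 on L^p(0,T) with the single bound
‖u'‖ ≤ K‖g‖ (`ZeroMaxReg`). Restricting to a shorter interval does not increase K
(`ZeroMaxReg.restrict`).

Perturbation. Since Bu = u' - g and u is the integral of u', the hypothesis on A gives ‖Au‖ ≤
(δ(K+1) + CTK)‖g‖. The first term is small by the choice of δ₀, the second on a short interval, and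
a Neumann series then solves the problem for B + A with constant 2K (`ZeroMaxReg.add_relBounded`). A
reflection argument doubles the interval (`ZeroMaxReg.double`). Iteration reaches any T with a
constant that does not depend on the operator (`ZeroMaxReg.exists_extend`), hence uniformly in A.
Nonzero initial values are handled by subtracting a function realizing the trace.

Generation. Well-posedness with zero initial value already forces a holomorphic semigroup
(`ZeroMaxReg.isHol`). For z in a small sector, zB is a positive multiple of a rotation of B, and the
rotation is a small perturbation. Perturbation, extension and time scaling therefore make zB well
posed on (0,1), with bounds uniform for |z| ≤ 1. Let P(z) map data to the derivative of the
solution. On a constant x the solution is the integral of e^{szB}x, so P(z)x is the orbit t ↦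
e^{tzB}x. Applying P(z) again yields the derivative of t e^{tzB}x, whose integral over (0,1) is
e^{zB}x; this explains `expOp`. A resolvent-type identity makes P holomorphic. The semigroup law is
checked for real times on the domain, then spread by the identity theorem and density. The generator
is identified using that B is closed. -/

lemma map_affine_volume_restrict (hh : h ≠ 0) (hJ : (fun t : ℝ => h * t + a) ⁻¹' I =ᵐ[volume] J) :
    Measure.map (fun t : ℝ => h * t + a) (volume.restrict J) =
      ENNReal.ofReal |h⁻¹| • volume.restrict I := by
  have he : MeasurableEmbedding (fun t : ℝ => h * t + a) :=
    (affineHomeomorph h a hh).measurableEmbedding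
  have hmap : Measure.map (fun t : ℝ => h * t + a) volume = ENNReal.ofReal |h⁻¹| • volume := by
    have : (fun t : ℝ => h * t + a) = (fun t => t + a) ∘ (fun t => h * t) := rfl
    rw [this, ← Measure.map_map (by fun_prop) (by fun_prop), Real.map_volume_mul_left hh,
      Measure.map_smul, (measurePreserving_add_right volume a).map_eq]
  rw [← Measure.restrict_congr_set hJ, ← he.restrict_map, hmap, Measure.restrict_smul]

lemma ae_comp_affine (hh : h ≠ 0) (hJ : (fun t : ℝ => h * t + a) ⁻¹' I =ᵐ[volume] J)
    {P : ℝ → Prop} (hP : ∀ᵐ t ∂volume.restrict I, P t) :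
    ∀ᵐ t ∂volume.restrict J, P (h * t + a) := by
  refine ae_of_ae_map (f := fun t : ℝ => h * t + a) (by fun_prop) ?_
  rw [map_affine_volume_restrict hh hJ]
  exact Measure.ae_smul_measure hP _

lemma MeasureTheory.MemLp.comp_affine {q : ℝ≥0∞} {f : ℝ → F} (hh : h ≠ 0)
    (hJ : (fun t : ℝ => h * t + a) ⁻¹' I =ᵐ[volume] J) (hf : MemLp f q (volume.restrict I)) :
    MemLp (fun t => f (h * t + a)) q (volume.restrict J) := by
  refine MemLp.comp_of_map (f := fun t : ℝ => h * t + a) (g := f) ?_ (by fun_prop)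
  rw [map_affine_volume_restrict hh hJ]
  exact hf.smul_measure (by simp)

lemma eLpNorm_comp_affine {q : ℝ≥0∞} (f : ℝ → F) (hh : h ≠ 0)
    (hJ : (fun t : ℝ => h * t + a) ⁻¹' I =ᵐ[volume] J) :
    eLpNorm (fun t => f (h * t + a)) q (volume.restrict J) =
      ENNReal.ofReal |h⁻¹| ^ (1 / q).toReal * eLpNorm f q (volume.restrict I) := by
  have he : MeasurableEmbedding (fun t : ℝ => h * t + a) :=
    (affineHomeomorph h a hh).measurableEmbedding
  have := he.eLpNorm_map_measure (g := f) (p := q) (μ := volume.restrict J)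
  rw [map_affine_volume_restrict hh hJ, eLpNorm_smul_measure_of_ne_zero (by simpa using hh)] at this
  exact this.symm

lemma preimage_mul_Ico {h T : ℝ} (hh : 0 < h) :
    (fun t : ℝ => h * t + 0) ⁻¹' Ico 0 T = Ico 0 (T / h) := by
  ext t
  simp [lt_div_iff₀ hh, mul_comm h, hh]

lemma preimage_add_Ico (a T : ℝ) :
    (fun t : ℝ => 1 * t + a) ⁻¹' Ico a (a + T) = Ico 0 T := by
  ext t
  simp [add_comm a]

lemma preimage_sub_Ico (a T : ℝ) :
    (fun t : ℝ => 1 * t + -a) ⁻¹' Ico 0 T = Ico a (a + T) := by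
  ext t
  simp only [mem_preimage, mem_Ico]
  constructor <;> rintro ⟨h1, h2⟩ <;> constructor <;> linarith

/-- Reflection moves the closed endpoint to the other side, so equality holds only up to a null set.
This is why the affine lemmas assume `hJ` almost everywhere. -/
lemma preimage_reflect_Ico (T : ℝ) :
    (fun t : ℝ => -1 * t + T) ⁻¹' Ico 0 T =ᵐ[volume] Ico 0 T := by
  have : (fun t : ℝ => -1 * t + T) ⁻¹' Ico 0 T = Ioc 0 T := by
    ext t
    simp only [mem_preimage, mem_Ico, mem_Ioc]
    constructor <;> rintro ⟨h1, h2⟩ <;> constructor <;> linarith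
  rw [this]
  exact Ico_ae_eq_Ioc.symm

lemma preimage_reflect_double_Ico (T : ℝ) :
    (fun t : ℝ => -1 * t + (T + T)) ⁻¹' Ico 0 T =ᵐ[volume] Ico T (T + T) := by
  have : (fun t : ℝ => -1 * t + (T + T)) ⁻¹' Ico 0 T = Ioc T (T + T) := by
    ext t
    simp only [mem_preimage, mem_Ico, mem_Ioc]
    constructor <;> rintro ⟨h1, h2⟩ <;> constructor <;> linarith
  rw [this]
  exact Ico_ae_eq_Ioc.symm

end Affine

/-! ### Solutions with zero initial value -/

section ZeroSolution

variable {E₀ E₁ : Type*} [NormedAddCommGroup E₀] [NormedSpace ℂ E₀]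
  [NormedAddCommGroup E₁] [NormedSpace ℂ E₁]

/-- `∫₀ᵗ f` is a solution on `[0, T)` of `u' - B u = g` with `u(0) = 0`, and `U` is its `E₁`-valued
version. -/
structure IsZeroSolution (ι : E₁ →L[ℂ] E₀) (p T : ℝ) (B : E₁ →L[ℂ] E₀)
    (g : ℝ → E₀) (U : ℝ → E₁) (f : ℝ → E₀) : Prop where
  memLp : MemLp U (ENNReal.ofReal p) (volume.restrict (Ico 0 T))
  memLp_deriv : MemLp f (ENNReal.ofReal p) (volume.restrict (Ico 0 T))
  ae_eq : ∀ᵐ t ∂volume.restrict (Ico 0 T), ι (U t) = ∫ s in (0 : ℝ)..t, f s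
  equation : ∀ᵐ t ∂volume.restrict (Ico 0 T), f t - B (U t) = g t

/-- Well-posedness in `L^p` on `[0, T)` of `u' - B u = g`, `u(0) = 0`, with the bound
`‖u'‖ ≤ K ‖g‖`. -/
structure ZeroMaxReg (ι : E₁ →L[ℂ] E₀) (p : ℝ) (K : NNReal) (T : ℝ) (B : E₁ →L[ℂ] E₀) :
    Prop where
  exists_sol : ∀ g : ℝ → E₀, MemLp g (ENNReal.ofReal p) (volume.restrict (Ico 0 T)) →
    ∃ U f, IsZeroSolution ι p T B g U f
  bound : ∀ g U f, IsZeroSolution ι p T B g U f →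
    eLpNorm f (ENNReal.ofReal p) (volume.restrict (Ico 0 T)) ≤
      K * eLpNorm g (ENNReal.ofReal p) (volume.restrict (Ico 0 T))

variable {ι : E₁ →L[ℂ] E₀} {p T : ℝ} {B : E₁ →L[ℂ] E₀}

lemma intervalIntegrable_of_memLp {F : Type*} [NormedAddCommGroup F]
    [Fact (1 ≤ ENNReal.ofReal p)] {f : ℝ → F}
    (hf : MemLp f (ENNReal.ofReal p) (volume.restrict (Ico 0 T))) {a b : ℝ}
    (ha : a ∈ Icc 0 T) (hb : b ∈ Icc 0 T) : IntervalIntegrable f volume a b := by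
  have h1 : IntegrableOn f (Ico 0 T) := hf.integrable Fact.out
  rw [intervalIntegrable_iff]
  rw [← integrableOn_Icc_iff_integrableOn_Ico] at h1
  exact h1.mono_set (uIoc_subset_uIcc.trans (uIcc_subset_Icc ha hb))

lemma intervalIntegral_congr_of_ae {F : Type*} [NormedAddCommGroup F] [NormedSpace ℝ F]
    {f g : ℝ → F} (h : f =ᵐ[volume.restrict (Ico 0 T)] g) {a b : ℝ}
    (ha : a ∈ Icc 0 T) (hb : b ∈ Icc 0 T) : ∫ s in a..b, f s = ∫ s in a..b, g s := by
  apply intervalIntegral.integral_congr_ae_restrict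
  have h1 : f =ᵐ[volume.restrict (Icc 0 T)] g := by
    rwa [Measure.restrict_congr_set Ico_ae_eq_Icc] at h
  exact ae_restrict_of_ae_restrict_of_subset
    (uIoc_subset_uIcc.trans (uIcc_subset_Icc ha hb)) h1

namespace IsZeroSolution

variable {g g' : ℝ → E₀} {U U' : ℝ → E₁} {f f' : ℝ → E₀}

lemma memLp_data (h : IsZeroSolution ι p T B g U f) :
    MemLp g (ENNReal.ofReal p) (volume.restrict (Ico 0 T)) :=
  (h.memLp_deriv.sub (B.comp_memLp' h.memLp)).ae_eq h.equation

lemma congr (h : IsZeroSolution ι p T B g U f) (hg : g =ᵐ[volume.restrict (Ico 0 T)] g')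
    (hU : U =ᵐ[volume.restrict (Ico 0 T)] U') (hf : f =ᵐ[volume.restrict (Ico 0 T)] f') :
    IsZeroSolution ι p T B g' U' f' where
  memLp := h.memLp.ae_eq hU
  memLp_deriv := h.memLp_deriv.ae_eq hf
  ae_eq := by
    filter_upwards [h.ae_eq, hU, ae_restrict_mem measurableSet_Ico] with t h1 h2 ht
    rw [← h2, h1]
    exact intervalIntegral_congr_of_ae hf ⟨le_rfl, ht.1.trans ht.2.le⟩ ⟨ht.1, ht.2.le⟩
  equation := by
    filter_upwards [h.equation, hU, hf, hg] with t h1 h2 h3 h4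
    rw [← h2, ← h3, ← h4, h1]

lemma congr_data (h : IsZeroSolution ι p T B g U f)
    (hg : g =ᵐ[volume.restrict (Ico 0 T)] g') : IsZeroSolution ι p T B g' U f :=
  h.congr hg .rfl .rfl

lemma congr_deriv (h : IsZeroSolution ι p T B g U f)
    (hf : f =ᵐ[volume.restrict (Ico 0 T)] f') : IsZeroSolution ι p T B g U f' :=
  h.congr .rfl .rfl hf

lemma add [Fact (1 ≤ ENNReal.ofReal p)] (h : IsZeroSolution ι p T B g U f)
    (h' : IsZeroSolution ι p T B g' U' f') :
    IsZeroSolution ι p T B (g + g') (U + U') (f + f') where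
  memLp := h.memLp.add h'.memLp
  memLp_deriv := h.memLp_deriv.add h'.memLp_deriv
  ae_eq := by
    filter_upwards [h.ae_eq, h'.ae_eq, ae_restrict_mem measurableSet_Ico] with t h1 h2 ht
    have h0 : (0 : ℝ) ∈ Icc 0 T := ⟨le_rfl, ht.1.trans ht.2.le⟩
    have ht : t ∈ Icc 0 T := ⟨ht.1, ht.2.le⟩
    simp only [Pi.add_apply, map_add, h1, h2]
    rw [intervalIntegral.integral_add (intervalIntegrable_of_memLp h.memLp_deriv h0 ht)
      (intervalIntegrable_of_memLp h'.memLp_deriv h0 ht)]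
  equation := by
    filter_upwards [h.equation, h'.equation] with t h1 h2
    simp only [Pi.add_apply, map_add, ← h1, ← h2]
    abel

lemma const_smul (h : IsZeroSolution ι p T B g U f) (c : ℂ) :
    IsZeroSolution ι p T B (c • g) (c • U) (c • f) where
  memLp := h.memLp.const_smul c
  memLp_deriv := h.memLp_deriv.const_smul c
  ae_eq := by
    filter_upwards [h.ae_eq] with t h1
    simp only [Pi.smul_apply, map_smul, h1, intervalIntegral.integral_smul]
  equation := by
    filter_upwards [h.equation] with t h1
    simp only [Pi.smul_apply, map_smul, ← h1, smul_sub]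

lemma neg (h : IsZeroSolution ι p T B g U f) : IsZeroSolution ι p T B (-g) (-U) (-f) := by
  simpa using h.const_smul (-1)

lemma sub [Fact (1 ≤ ENNReal.ofReal p)] (h : IsZeroSolution ι p T B g U f)
    (h' : IsZeroSolution ι p T B g' U' f') :
    IsZeroSolution ι p T B (g - g') (U - U') (f - f') := by
  simpa [sub_eq_add_neg] using h.add h'.neg

lemma restrict (h : IsZeroSolution ι p T B g U f) {T' : ℝ} (hT : T' ≤ T) :
    IsZeroSolution ι p T' B g U f :=
  have hs : Ico 0 T' ⊆ Ico 0 T := Ico_subset_Ico_right hT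
  { memLp := h.memLp.mono_measure (Measure.restrict_mono_set _ hs)
    memLp_deriv := h.memLp_deriv.mono_measure (Measure.restrict_mono_set _ hs)
    ae_eq := ae_restrict_of_ae_restrict_of_subset hs h.ae_eq
    equation := ae_restrict_of_ae_restrict_of_subset hs h.equation }

/-- Rescaling time by the factor `c`. -/
lemma rescale (h : IsZeroSolution ι p T B g U f) {c : ℝ} (hc : 0 < c) :
    IsZeroSolution ι p (T / c) ((c : ℂ) • B) (fun t => (c : ℂ) • g (c * t)) (fun t => U (c * t))
      (fun t => (c : ℂ) • f (c * t)) := by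
  have hJ : (fun t : ℝ => c * t + 0) ⁻¹' Ico 0 T =ᵐ[volume] Ico 0 (T / c) := by
    rw [preimage_mul_Ico hc]; rfl
  refine ⟨?_, ?_, ?_, ?_⟩
  · simpa using h.memLp.comp_affine hc.ne' hJ
  · have := (h.memLp_deriv.comp_affine hc.ne' hJ).const_smul (c : ℂ)
    simp only [add_zero] at this
    exact this
  · filter_upwards [ae_comp_affine hc.ne' hJ h.ae_eq] with t ht
    rw [add_zero] at ht
    rw [ht, intervalIntegral.integral_smul, Complex.coe_smul,
      intervalIntegral.smul_integral_comp_mul_left, mul_zero]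
  · filter_upwards [ae_comp_affine hc.ne' hJ h.equation] with t ht
    rw [add_zero] at ht
    simp [← ht, smul_sub]

/-- Delaying by `a`, with value `0` up to time `a`. -/
lemma delay (h : IsZeroSolution ι p T B g U f) {a : ℝ} (ha : 0 ≤ a) :
    IsZeroSolution ι p (a + T) B ((Ici a).indicator fun t => g (t - a))
      ((Ici a).indicator fun t => U (t - a)) ((Ici a).indicator fun t => f (t - a)) := by
  have hJ : (fun t : ℝ => 1 * t + -a) ⁻¹' Ico 0 T =ᵐ[volume] Ico a (a + T) := by
    rw [preimage_sub_Ico]; rfl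
  have hI : (volume.restrict (Ico 0 (a + T))).restrict (Ici a) =
      volume.restrict (Ico a (a + T)) := by
    rw [Measure.restrict_restrict measurableSet_Ici]
    congr 1
    ext t
    simp only [mem_inter_iff, mem_Ici, mem_Ico]
    constructor
    · rintro ⟨h1, -, h3⟩
      exact ⟨h1, h3⟩
    · rintro ⟨h1, h3⟩
      exact ⟨h1, ha.trans h1, h3⟩
  have key : ∀ {P : ℝ → Prop}, (∀ᵐ t ∂volume.restrict (Ico a (a + T)), P t) →
      ∀ᵐ t ∂volume.restrict (Ico 0 (a + T)), t ∈ Ici a → P t := by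
    intro P hP
    rwa [← hI, ae_restrict_iff' measurableSet_Ici] at hP
  refine ⟨?_, ?_, ?_, ?_⟩
  · rw [memLp_indicator_iff_restrict measurableSet_Ici, hI]
    simpa [sub_eq_add_neg] using h.memLp.comp_affine one_ne_zero hJ
  · rw [memLp_indicator_iff_restrict measurableSet_Ici, hI]
    simpa [sub_eq_add_neg] using h.memLp_deriv.comp_affine one_ne_zero hJ
  · filter_upwards [key (ae_comp_affine one_ne_zero hJ h.ae_eq),
      ae_restrict_mem measurableSet_Ico] with t ht ht0
    by_cases hta : a ≤ t
    · specialize ht hta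
      rw [one_mul, ← sub_eq_add_neg] at ht
      rw [indicator_of_mem (mem_Ici.2 hta), ht, intervalIntegral.integral_of_le ht0.1,
        integral_indicator measurableSet_Ici, Measure.restrict_restrict measurableSet_Ici]
      have : (Ici a ∩ Ioc 0 t : Set ℝ) =ᵐ[volume] (Ioc a t : Set ℝ) := by
        have h1 : (Ici a ∩ Ioc 0 t : Set ℝ) =ᵐ[volume] (Ioi a ∩ Ioc 0 t : Set ℝ) :=
          Ioi_ae_eq_Ici.symm.inter .rfl
        have h2 : Ioi a ∩ Ioc 0 t = Ioc a t := by
          ext s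
          simp only [mem_inter_iff, mem_Ioi, mem_Ioc]
          constructor
          · rintro ⟨h1, -, h3⟩
            exact ⟨h1, h3⟩
          · rintro ⟨h1, h3⟩
            exact ⟨h1, ha.trans_lt h1, h3⟩
        rwa [h2] at h1
      rw [Measure.restrict_congr_set this, ← intervalIntegral.integral_of_le hta,
        intervalIntegral.integral_comp_sub_right, sub_self]
    · rw [indicator_of_notMem (by simpa using hta), map_zero]
      symm
      apply intervalIntegral.integral_zero_ae
      refine .of_forall fun s hs => indicator_of_notMem ?_ _
      rw [uIoc_of_le ht0.1] at hs
      simp only [mem_Ici, not_le]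
      exact hs.2.trans_lt (not_le.1 hta)
  · filter_upwards [key (ae_comp_affine one_ne_zero hJ h.equation)] with t ht
    by_cases hta : t ∈ Ici a
    · specialize ht hta
      rw [one_mul, ← sub_eq_add_neg] at ht
      simpa [indicator_of_mem hta] using ht
    · simp [indicator_of_notMem hta]

end IsZeroSolution

end ZeroSolution

/-! ### Changing the time interval -/

section Interval

variable {E₀ E₁ : Type*} [NormedAddCommGroup E₀] [NormedSpace ℂ E₀]
  [NormedAddCommGroup E₁] [NormedSpace ℂ E₁]
  {ι : E₁ →L[ℂ] E₀} {p T : ℝ} {B : E₁ →L[ℂ] E₀} {K : NNReal}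

namespace ZeroMaxReg

lemma ae_eq_zero [Fact (1 ≤ ENNReal.ofReal p)] (h : ZeroMaxReg ι p K T B) {g : ℝ → E₀}
    {U : ℝ → E₁} {f : ℝ → E₀}
    (hs : IsZeroSolution ι p T B g U f) (hg : g =ᵐ[volume.restrict (Ico 0 T)] 0) :
    f =ᵐ[volume.restrict (Ico 0 T)] 0 := by
  have h1 := h.bound _ _ _ hs
  rw [eLpNorm_congr_ae hg, eLpNorm_zero, mul_zero, nonpos_iff_eq_zero] at h1
  exact (eLpNorm_eq_zero_iff hs.memLp_deriv.1
    (one_pos.trans_le (Fact.out : 1 ≤ ENNReal.ofReal p)).ne').1 h1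

lemma ae_unique [Fact (1 ≤ ENNReal.ofReal p)] (h : ZeroMaxReg ι p K T B)
    {g g' : ℝ → E₀} {U U' : ℝ → E₁} {f f' : ℝ → E₀} (hs : IsZeroSolution ι p T B g U f)
    (hs' : IsZeroSolution ι p T B g' U' f') (hg : g =ᵐ[volume.restrict (Ico 0 T)] g') :
    f =ᵐ[volume.restrict (Ico 0 T)] f' := by
  have h1 : g - g' =ᵐ[volume.restrict (Ico 0 T)] 0 := by
    filter_upwards [hg] with t ht
    simp [ht]
  filter_upwards [h.ae_eq_zero (hs.sub hs') h1] with t ht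
  exact sub_eq_zero.1 ht

/-- Scaling time multiplies the norms of data and derivative by the same factor, so K is unchanged.
-/
lemma rescale (h : ZeroMaxReg ι p K T B) {c : ℝ} (hc : 0 < c) :
    ZeroMaxReg ι p K (T / c) ((c : ℂ) • B) where
  exists_sol g hg := by
    have hJ : (fun t : ℝ => c⁻¹ * t + 0) ⁻¹' Ico 0 (T / c) =ᵐ[volume] Ico 0 T := by
      rw [preimage_mul_Ico (inv_pos.2 hc)]
      have : T / c / c⁻¹ = T := by field_simp
      rw [this]; rfl
    have h1 := (hg.comp_affine (inv_pos.2 hc).ne' hJ).const_smul ((c : ℂ)⁻¹)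
    obtain ⟨U, f, hs⟩ := h.exists_sol _ h1
    refine ⟨_, _, (hs.rescale hc).congr_data (.of_forall fun t => ?_)⟩
    simp [smul_smul, hc.ne']
  bound g U f hs := by
    have hc' : 0 < c⁻¹ := inv_pos.2 hc
    have hT : T / c / c⁻¹ = T := by field_simp
    have hB : ((c⁻¹ : ℝ) : ℂ) • (c : ℂ) • B = B := by
      rw [smul_smul, ← Complex.ofReal_mul, inv_mul_cancel₀ hc.ne', Complex.ofReal_one, one_smul]
    have hJ : (fun t : ℝ => c⁻¹ * t + 0) ⁻¹' Ico 0 (T / c) =ᵐ[volume] Ico 0 T := by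
      rw [preimage_mul_Ico hc', hT]; rfl
    have h1 := hs.rescale hc'
    rw [hT, hB] at h1
    have h2 := h.bound _ _ _ h1
    have key : ∀ φ : ℝ → E₀, eLpNorm (fun t => ((c⁻¹ : ℝ) : ℂ) • φ (c⁻¹ * t)) (ENNReal.ofReal p)
        (volume.restrict (Ico 0 T)) = (‖((c⁻¹ : ℝ) : ℂ)‖ₑ *
          ENNReal.ofReal |c⁻¹⁻¹| ^ (1 / ENNReal.ofReal p).toReal) *
          eLpNorm φ (ENNReal.ofReal p) (volume.restrict (Ico 0 (T / c))) := by
      intro φ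
      have h3 := eLpNorm_comp_affine (q := ENNReal.ofReal p) φ hc'.ne' hJ
      simp only [add_zero] at h3
      rw [mul_assoc, ← h3, ← eLpNorm_const_smul]
      rfl
    rw [key, key, mul_left_comm] at h2
    refine (ENNReal.mul_le_mul_iff_right ?_ ?_).1 h2
    · refine mul_ne_zero (by simpa using hc.ne')
        (ENNReal.rpow_pos (by simpa using hc.ne') (by simp)).ne'
    · exact ENNReal.mul_ne_top (by simp) (ENNReal.rpow_ne_top_of_nonneg (by simp) (by simp))

/-- For existence the data are extended by zero. For the bound the solution is delayed by T - T', so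
that it ends exactly at T; the delay preserves all norms, hence the same K. -/
lemma restrict [Fact (1 ≤ ENNReal.ofReal p)] (h : ZeroMaxReg ι p K T B) {T' : ℝ} (hT : T' ≤ T) :
    ZeroMaxReg ι p K T' B where
  exists_sol g hg := by
    have h1 : MemLp ((Ico 0 T').indicator g) (ENNReal.ofReal p) (volume.restrict (Ico 0 T)) := by
      rw [memLp_indicator_iff_restrict measurableSet_Ico,
        Measure.restrict_restrict_of_subset (Ico_subset_Ico_right hT)]
      exact hg
    obtain ⟨U, f, hs⟩ := h.exists_sol _ h1
    refine ⟨U, f, (hs.restrict hT).congr_data ?_⟩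
    filter_upwards [ae_restrict_mem measurableSet_Ico] with t ht
    rw [indicator_of_mem ht]
  bound g U f hs := by
    have h1 := hs.delay (sub_nonneg.2 hT)
    have hJ : (fun t : ℝ => 1 * t + -(T - T')) ⁻¹' Ico 0 T' =ᵐ[volume] Ico (T - T') (T - T' + T') := by
      rw [preimage_sub_Ico]; rfl
    have key : ∀ φ : ℝ → E₀, eLpNorm ((Ici (T - T')).indicator fun t => φ (t - (T - T')))
        (ENNReal.ofReal p) (volume.restrict (Ico 0 (T - T' + T'))) =
        eLpNorm φ (ENNReal.ofReal p) (volume.restrict (Ico 0 T')) := by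
      intro φ
      have h3 := eLpNorm_comp_affine (q := ENNReal.ofReal p) φ one_ne_zero hJ
      rw [eLpNorm_indicator_eq_eLpNorm_restrict measurableSet_Ici,
        Measure.restrict_restrict measurableSet_Ici]
      have : Ici (T - T') ∩ Ico 0 (T - T' + T') = Ico (T - T') (T - T' + T') := by
        ext t
        simp only [mem_inter_iff, mem_Ici, mem_Ico]
        constructor
        · rintro ⟨h1, -, h3⟩
          exact ⟨h1, h3⟩
        · rintro ⟨h1, h3⟩
          exact ⟨h1, (sub_nonneg.2 hT).trans h1, h3⟩
      rw [this]
      simpa [sub_eq_add_neg] using h3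
    have h2 := h.bound _ _ _ (by rwa [sub_add_cancel] at h1)
    rw [sub_add_cancel] at key
    rwa [key, key] at h2

end ZeroMaxReg

/-! ### Norms and reflections on a doubled interval. -/

section Doubling

variable {F : Type*} [NormedAddCommGroup F]

lemma MeasureTheory.MemLp.comp_add_left_Ico {q : ℝ≥0∞} {f : ℝ → F} (hT : 0 ≤ T)
    (hf : MemLp f q (volume.restrict (Ico 0 (T + T)))) :
    MemLp (fun t => f (T + t)) q (volume.restrict (Ico 0 T)) := by
  have hJ : (fun t : ℝ => 1 * t + T) ⁻¹' Ico T (T + T) =ᵐ[volume] Ico 0 T := by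
    rw [preimage_add_Ico]; rfl
  have := (hf.mono_measure (Measure.restrict_mono_set _
    (Ico_subset_Ico_left hT))).comp_affine one_ne_zero hJ
  simpa [add_comm] using this

lemma MeasureTheory.MemLp.comp_sub_left_Ico {q : ℝ≥0∞} {f : ℝ → F}
    (hf : MemLp f q (volume.restrict (Ico 0 T))) :
    MemLp (fun t => f (T - t)) q (volume.restrict (Ico 0 T)) := by
  have := hf.comp_affine (by norm_num) (preimage_reflect_Ico T)
  simpa [add_comm, sub_eq_add_neg] using this

lemma eLpNorm_comp_sub_left_Ico {q : ℝ≥0∞} (f : ℝ → F) :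
    eLpNorm (fun t => f (T - t)) q (volume.restrict (Ico 0 T)) =
      eLpNorm f q (volume.restrict (Ico 0 T)) := by
  have := eLpNorm_comp_affine (q := q) f (by norm_num) (preimage_reflect_Ico T)
  simpa [add_comm, sub_eq_add_neg, -neg_mul, neg_one_mul] using this

lemma eLpNorm_comp_add_left_Ico {q : ℝ≥0∞} (f : ℝ → F) :
    eLpNorm (fun t => f (T + t)) q (volume.restrict (Ico 0 T)) =
      eLpNorm f q (volume.restrict (Ico T (T + T))) := by
  have hJ : (fun t : ℝ => 1 * t + T) ⁻¹' Ico T (T + T) =ᵐ[volume] Ico 0 T := by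
    rw [preimage_add_Ico]; rfl
  have := eLpNorm_comp_affine (q := q) f one_ne_zero hJ
  simpa [add_comm] using this

lemma eLpNorm_double_le {q : ℝ≥0∞} (hq : 1 ≤ q) {f : ℝ → F} (hT : 0 ≤ T)
    (hf : MemLp f q (volume.restrict (Ico 0 (T + T)))) :
    eLpNorm f q (volume.restrict (Ico 0 (T + T))) ≤
      eLpNorm f q (volume.restrict (Ico 0 T)) +
        eLpNorm (fun t => f (T + t)) q (volume.restrict (Ico 0 T)) := by
  have h1 : f =ᵐ[volume.restrict (Ico 0 (T + T))]
      (Ico 0 T).indicator f + (Ico T (T + T)).indicator f := by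
    filter_upwards [ae_restrict_mem measurableSet_Ico] with t ht
    by_cases h : t < T
    · simp [indicator, ht.1, h]
    · simp [indicator, ht.2, h, not_lt.1 h]
  rw [eLpNorm_congr_ae h1, eLpNorm_comp_add_left_Ico]
  refine (eLpNorm_add_le (hf.1.indicator measurableSet_Ico) (hf.1.indicator measurableSet_Ico)
    hq).trans_eq ?_
  rw [eLpNorm_indicator_eq_eLpNorm_restrict measurableSet_Ico,
    eLpNorm_indicator_eq_eLpNorm_restrict measurableSet_Ico,
    Measure.restrict_restrict_of_subset (Ico_subset_Ico_right (by linarith)),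
    Measure.restrict_restrict_of_subset (Ico_subset_Ico_left hT)]

lemma MeasureTheory.MemLp.glue {q : ℝ≥0∞} {φ ψ : ℝ → F} (hT : 0 ≤ T)
    (h1 : MemLp φ q (volume.restrict (Ico 0 T)))
    (h2 : MemLp ψ q (volume.restrict (Ico T (T + T)))) :
    MemLp (fun t => if t < T then φ t else ψ t) q (volume.restrict (Ico 0 (T + T))) := by
  have h3 : MemLp ((Ico 0 T).indicator φ + (Ico T (T + T)).indicator ψ) q
      (volume.restrict (Ico 0 (T + T))) := by
    refine MemLp.add ?_ ?_
    · rwa [memLp_indicator_iff_restrict measurableSet_Ico,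
        Measure.restrict_restrict_of_subset (Ico_subset_Ico_right (by linarith))]
    · rwa [memLp_indicator_iff_restrict measurableSet_Ico,
        Measure.restrict_restrict_of_subset (Ico_subset_Ico_left hT)]
  refine h3.ae_eq ?_
  filter_upwards [ae_restrict_mem measurableSet_Ico] with t ht
  by_cases hlt : t < T
  · simp [ht.1, hlt]
  · simp [ht.2, hlt, not_lt.1 hlt]

end Doubling

lemma ae_comp_add_left_Ico {P : ℝ → Prop} (hT : 0 ≤ T)
    (h : ∀ᵐ t ∂volume.restrict (Ico 0 (T + T)), P t) :
    ∀ᵐ t ∂volume.restrict (Ico 0 T), P (T + t) := by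
  have hJ : (fun t : ℝ => 1 * t + T) ⁻¹' Ico T (T + T) =ᵐ[volume] Ico 0 T := by
    rw [preimage_add_Ico]; rfl
  have := ae_comp_affine one_ne_zero hJ
    (ae_restrict_of_ae_restrict_of_subset (Ico_subset_Ico_left hT) h)
  simpa [add_comm] using this

lemma ae_comp_sub_left_Ico {P : ℝ → Prop}
    (h : ∀ᵐ t ∂volume.restrict (Ico 0 T), P t) :
    ∀ᵐ t ∂volume.restrict (Ico 0 T), P (T - t) := by
  have := ae_comp_affine (by norm_num) (preimage_reflect_Ico T) h
  simpa [add_comm, sub_eq_add_neg] using this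

/-- A solution on `[0, 2T)` minus the reflection at `T` of its restriction to `[0, T)`. -/
lemma IsZeroSolution.sub_reflect [Fact (1 ≤ ENNReal.ofReal p)] {g : ℝ → E₀} {U : ℝ → E₁}
    {f : ℝ → E₀} (hT : 0 ≤ T) (h : IsZeroSolution ι p (T + T) B g U f) :
    IsZeroSolution ι p T B (fun t => g (T + t) + (2 : ℂ) • f (T - t) - g (T - t))
      (fun t => U (T + t) - U (T - t)) (fun t => f (T + t) + f (T - t)) := by
  have h' := h.restrict (by linarith : T ≤ T + T)
  have hf1 := h.memLp_deriv.comp_add_left_Ico hT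
  have hf2 := h'.memLp_deriv.comp_sub_left_Ico
  refine ⟨(h.memLp.comp_add_left_Ico hT).sub h'.memLp.comp_sub_left_Ico, hf1.add hf2, ?_, ?_⟩
  · filter_upwards [ae_comp_add_left_Ico hT h.ae_eq, ae_comp_sub_left_Ico h'.ae_eq,
      ae_restrict_mem measurableSet_Ico] with t h1 h2 ht
    have h0 : (0 : ℝ) ∈ Icc 0 T := ⟨le_rfl, hT⟩
    have ht' : t ∈ Icc 0 T := ⟨ht.1, ht.2.le⟩
    rw [intervalIntegral.integral_add (intervalIntegrable_of_memLp hf1 h0 ht')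
      (intervalIntegrable_of_memLp hf2 h0 ht'), intervalIntegral.integral_comp_add_left,
      intervalIntegral.integral_comp_sub_left, map_sub, h1, h2, add_zero, sub_zero,
      add_comm (∫ s in T..T + t, f s), intervalIntegral.integral_add_adjacent_intervals,
      intervalIntegral.integral_interval_sub_left]
    all_goals
      refine intervalIntegrable_of_memLp h.memLp_deriv ?_ ?_ <;> constructor <;>
        linarith [ht.1, ht.2]
  · filter_upwards [ae_comp_add_left_Ico hT h.equation, ae_comp_sub_left_Ico h'.equation]
      with t h1 h2
    rw [← h1, ← h2, map_sub, two_smul]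
    abel

/-- Continuing a solution on `[0, T)` to `[0, 2T)` by reflection plus a solution with zero initial
value. -/
lemma IsZeroSolution.glue_reflect [Fact (1 ≤ ENNReal.ofReal p)] {g : ℝ → E₀} {U Z : ℝ → E₁}
    {f k : ℝ → E₀} (hT : 0 ≤ T) (h : IsZeroSolution ι p T B g U f)
    (hZ : IsZeroSolution ι p T B (fun t => g (T + t) + (2 : ℂ) • f (T - t) - g (T - t)) Z k) :
    IsZeroSolution ι p (T + T) B g (fun t => if t < T then U t else Z (t - T) + U (T + T - t))
      (fun t => if t < T then f t else k (t - T) - f (T + T - t)) := by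
  have hJ : (fun t : ℝ => 1 * t + -T) ⁻¹' Ico 0 T =ᵐ[volume] Ico T (T + T) := by
    rw [preimage_sub_Ico]; rfl
  have hJ' := preimage_reflect_double_Ico T
  have hsplit : Ico 0 (T + T) = Ico 0 T ∪ Ico T (T + T) :=
    (Ico_union_Ico_eq_Ico hT (by linarith)).symm
  have hae : ∀ {P : ℝ → Prop}, (∀ᵐ t ∂volume.restrict (Ico 0 T), t < T → P t) →
      (∀ᵐ t ∂volume.restrict (Ico T (T + T)), ¬ t < T → P t) →
      ∀ᵐ t ∂volume.restrict (Ico 0 (T + T)), P t := by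
    intro P h1 h2
    rw [hsplit, ae_restrict_union_iff]
    constructor
    · filter_upwards [h1, ae_restrict_mem measurableSet_Ico] with t ht ht'
      exact ht ht'.2
    · filter_upwards [h2, ae_restrict_mem measurableSet_Ico] with t ht ht'
      exact ht (not_lt.2 ht'.1)
  have hk := hZ.memLp_deriv.comp_affine one_ne_zero hJ
  have hf := h.memLp_deriv.comp_affine (by norm_num) hJ'
  have hZ1 := hZ.memLp.comp_affine one_ne_zero hJ
  have hU := h.memLp.comp_affine (by norm_num) hJ'
  simp only [one_mul, neg_mul, neg_add_eq_sub, ← sub_eq_add_neg] at hk hf hZ1 hU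
  have hmemf := h.memLp_deriv.glue hT (hk.sub hf)
  refine ⟨h.memLp.glue hT (hZ1.add hU), hmemf, hae ?_ ?_, hae ?_ ?_⟩
  · filter_upwards [h.ae_eq, ae_restrict_mem measurableSet_Ico] with t h1 ht hlt
    rw [if_pos hlt, h1]
    refine intervalIntegral.integral_congr fun s hs => ?_
    rw [uIcc_of_le ht.1] at hs
    simp [hs.2.trans_lt hlt]
  · filter_upwards [ae_comp_affine one_ne_zero hJ hZ.ae_eq,
      ae_comp_affine (by norm_num) hJ' h.ae_eq, ae_restrict_mem measurableSet_Ico]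
      with t h1 h2 ht hlt
    simp only [one_mul, neg_mul, neg_add_eq_sub, ← sub_eq_add_neg] at h1 h2
    rw [if_neg hlt, map_add, h1, h2]
    have e1 : ∫ s in (0 : ℝ)..T, (if s < T then f s else k (s - T) - f (T + T - s)) =
        ∫ s in (0 : ℝ)..T, f s := by
      apply intervalIntegral.integral_congr_ae
      -- At s = T the conditional already takes its second branch; this single point is discarded.
      have : ∀ᵐ s : ℝ, s ≠ T := by simp [ae_iff, measure_singleton]
      filter_upwards [this] with s hs hs'
      rw [uIoc_of_le hT] at hs'
      simp [lt_of_le_of_ne hs'.2 hs]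
    have e2 : ∫ s in T..t, (if s < T then f s else k (s - T) - f (T + T - s)) =
        ∫ s in T..t, (k (s - T) - f (T + T - s)) := by
      refine intervalIntegral.integral_congr fun s hs => ?_
      rw [uIcc_of_le ht.1] at hs
      simp [not_lt.2 hs.1]
    have i1 : IntervalIntegrable k volume (T - T) (t - T) := by
      refine intervalIntegrable_of_memLp hZ.memLp_deriv ?_ ?_ <;> constructor <;>
        linarith [ht.1, ht.2]
    have i2 : IntervalIntegrable f volume (T + T - T) (T + T - t) := by
      refine intervalIntegrable_of_memLp h.memLp_deriv ?_ ?_ <;> constructor <;>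
        linarith [ht.1, ht.2]
    have i1' : IntervalIntegrable (fun s => k (s - T)) volume T t := by
      simpa using i1.comp_sub_right T
    have i2' : IntervalIntegrable (fun s => f (T + T - s)) volume T t := by
      simpa using i2.comp_sub_left (T + T)
    rw [← intervalIntegral.integral_add_adjacent_intervals
      (a := 0) (b := T) (c := t), e1, e2, intervalIntegral.integral_sub i1' i2',
      intervalIntegral.integral_comp_sub_right, intervalIntegral.integral_comp_sub_left, sub_self,
      add_sub_cancel_right]
    · have : ∫ s in (0 : ℝ)..T, f s =
          (∫ s in (0 : ℝ)..(T + T - t), f s) + ∫ s in (T + T - t)..T, f s := by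
        rw [intervalIntegral.integral_add_adjacent_intervals]
        all_goals
          refine intervalIntegrable_of_memLp h.memLp_deriv ?_ ?_ <;> constructor <;>
            linarith [ht.1, ht.2]
      rw [this]
      abel
    · refine intervalIntegrable_of_memLp hmemf ?_ ?_ <;> constructor <;> linarith [ht.1, ht.2]
    · refine intervalIntegrable_of_memLp hmemf ?_ ?_ <;> constructor <;> linarith [ht.1, ht.2]
  · filter_upwards [h.equation] with t h1 hlt
    simp [hlt, h1]
  · filter_upwards [ae_comp_affine one_ne_zero hJ hZ.equation,
      ae_comp_affine (by norm_num) hJ' h.equation] with t h1 h2 hlt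
    simp only [one_mul, neg_mul, neg_add_eq_sub, ← sub_eq_add_neg] at h1 h2
    rw [if_neg hlt, if_neg hlt, map_add]
    have e : T - (t - T) = T + T - t := by ring
    have e' : T + (t - T) = t := by ring
    rw [e, e', two_smul] at h1
    have : B (U (T + T - t)) = f (T + T - t) - g (T + T - t) := by rw [← h2]; abel
    rw [this, eq_sub_iff_add_eq] at *
    rw [← sub_eq_zero] at h1 ⊢
    rw [← h1]
    abel

/-- The difference z(t) = u(T+t) - u(T-t) vanishes at 0 and solves the problem with data g(T+t) +
2u'(T-t) - g(T-t), where the last two terms are u' + Bu at T - t. With G = ‖g‖, the first half costs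
KG and the second K(2G + 2KG) + KG. -/
lemma ZeroMaxReg.double [Fact (1 ≤ ENNReal.ofReal p)] (h : ZeroMaxReg ι p K T B) (hT : 0 ≤ T) :
    ZeroMaxReg ι p (4 * K + 2 * K ^ 2) (T + T) B where
  exists_sol g hg := by
    have hg' := hg.mono_measure (Measure.restrict_mono_set volume
      (Ico_subset_Ico_right (by linarith : T ≤ T + T)))
    obtain ⟨U, f, hs⟩ := h.exists_sol g hg'
    obtain ⟨Z, k, hZ⟩ := h.exists_sol (fun t => g (T + t) + (2 : ℂ) • f (T - t) - g (T - t))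
      (((hg.comp_add_left_Ico hT).add (hs.memLp_deriv.comp_sub_left_Ico.const_smul _)).sub
        hg'.comp_sub_left_Ico)
    exact ⟨_, _, hs.glue_reflect hT hZ⟩
  bound g U f hs := by
    have hq : 1 ≤ ENNReal.ofReal p := Fact.out
    have hs' := hs.restrict (by linarith : T ≤ T + T)
    have hr := hs.sub_reflect hT
    have b1 := h.bound _ _ _ hs'
    have b2 := h.bound _ _ _ hr
    have hg := hs.memLp_data
    have hg1 := hg.comp_add_left_Ico hT
    have hg2 := hs'.memLp_data.comp_sub_left_Ico
    have hf1 := hs.memLp_deriv.comp_add_left_Ico hT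
    have hf2 := hs'.memLp_deriv.comp_sub_left_Ico
    set G := eLpNorm g (ENNReal.ofReal p) (volume.restrict (Ico 0 (T + T)))
    have g1 : eLpNorm g (ENNReal.ofReal p) (volume.restrict (Ico 0 T)) ≤ G :=
      eLpNorm_mono_measure _ (Measure.restrict_mono_set _ (Ico_subset_Ico_right (by linarith)))
    have g2 : eLpNorm (fun t => g (T + t)) (ENNReal.ofReal p) (volume.restrict (Ico 0 T)) ≤ G := by
      rw [eLpNorm_comp_add_left_Ico]
      exact eLpNorm_mono_measure _ (Measure.restrict_mono_set _ (Ico_subset_Ico_left hT))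
    have b1' : eLpNorm f (ENNReal.ofReal p) (volume.restrict (Ico 0 T)) ≤ K * G :=
      b1.trans (by gcongr)
    have b3 : eLpNorm (fun t => g (T + t) + (2 : ℂ) • f (T - t) - g (T - t)) (ENNReal.ofReal p)
        (volume.restrict (Ico 0 T)) ≤ G + 2 * (K * G) + G := by
      refine (eLpNorm_sub_le (hg1.add (hf2.const_smul _)).1 hg2.1 hq).trans ?_
      refine add_le_add ((eLpNorm_add_le hg1.1 (hf2.const_smul (2 : ℂ)).1 hq).trans
        (add_le_add g2 ?_)) ?_
      · refine (eLpNorm_const_smul _ _ _ _).trans_le ?_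
        rw [eLpNorm_comp_sub_left_Ico]
        refine mul_le_mul' (le_of_eq ?_) b1'
        rw [← ofReal_norm]
        simp
      · rw [eLpNorm_comp_sub_left_Ico]
        exact g1
    have b4 : eLpNorm (fun t => f (T + t)) (ENNReal.ofReal p) (volume.restrict (Ico 0 T)) ≤
        K * (G + 2 * (K * G) + G) + K * G := by
      have e : (fun t => f (T + t)) = (fun t => f (T + t) + f (T - t)) - fun t => f (T - t) := by
        ext t
        simp
      rw [e]
      refine (eLpNorm_sub_le (hf1.add hf2).1 hf2.1 hq).trans (add_le_add (b2.trans (by gcongr)) ?_)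
      rw [eLpNorm_comp_sub_left_Ico]
      exact b1'
    refine (eLpNorm_double_le hq hT hs.memLp_deriv).trans ((add_le_add b1' b4).trans_eq ?_)
    push_cast
    ring

end Interval

/-! ### Solution operators and perturbation -/

section SolutionOperator

variable {E₀ E₁ : Type*} [NormedAddCommGroup E₀] [NormedSpace ℂ E₀]
  [NormedAddCommGroup E₁] [NormedSpace ℂ E₁]
  {ι : E₁ →L[ℂ] E₀} {p T : ℝ} {B : E₁ →L[ℂ] E₀} {K : NNReal}

lemma enorm_integral_le_eLpNorm_one {f : ℝ → E₀} {t : ℝ} (ht : t ∈ Icc 0 T) :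
    ‖∫ s in (0 : ℝ)..t, f s‖ₑ ≤ eLpNorm f 1 (volume.restrict (Ico 0 T)) := by
  rw [intervalIntegral.integral_of_le ht.1, eLpNorm_one_eq_lintegral_enorm,
    Measure.restrict_congr_set Ico_ae_eq_Ioc]
  exact (enorm_integral_le_lintegral_enorm _).trans
    (lintegral_mono_set (Ioc_subset_Ioc_right ht.2))

lemma enorm_integral_le_eLpNorm [hq : Fact (1 ≤ ENNReal.ofReal p)] {f : ℝ → E₀} {t : ℝ}
    (hf : MemLp f (ENNReal.ofReal p) (volume.restrict (Ico 0 T))) (ht : t ∈ Icc 0 T) :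
    ‖∫ s in (0 : ℝ)..t, f s‖ₑ ≤ eLpNorm f (ENNReal.ofReal p) (volume.restrict (Ico 0 T)) *
      ENNReal.ofReal T ^ (1 - 1 / (ENNReal.ofReal p).toReal) := by
  refine (enorm_integral_le_eLpNorm_one ht).trans
    ((eLpNorm_le_eLpNorm_mul_rpow_measure_univ hq.out hf.1).trans_eq ?_)
  simp

/-- Hölder gives a pointwise factor T^{1-1/p}, and the outer L^p norm contributes T^{1/p}. The
resulting factor T makes the lower-order term small on short intervals. -/
lemma eLpNorm_integral_le [hq : Fact (1 ≤ ENNReal.ofReal p)] {f : ℝ → E₀}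
    (hf : MemLp f (ENNReal.ofReal p) (volume.restrict (Ico 0 T))) :
    eLpNorm (fun t => ∫ s in (0 : ℝ)..t, f s) (ENNReal.ofReal p) (volume.restrict (Ico 0 T)) ≤
      ENNReal.ofReal T * eLpNorm f (ENNReal.ofReal p) (volume.restrict (Ico 0 T)) := by
  have h1 : ∀ᵐ t ∂volume.restrict (Ico 0 T), ‖∫ s in (0 : ℝ)..t, f s‖ₑ ≤
      eLpNorm f (ENNReal.ofReal p) (volume.restrict (Ico 0 T)) *
      ENNReal.ofReal T ^ (1 - 1 / (ENNReal.ofReal p).toReal) := by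
    filter_upwards [ae_restrict_mem measurableSet_Ico] with t ht
    exact enorm_integral_le_eLpNorm hf ⟨ht.1, ht.2.le⟩
  refine (eLpNorm_le_of_ae_enorm_bound h1).trans_eq ?_
  have hq1 : 1 ≤ (ENNReal.ofReal p).toReal := by
    have := ENNReal.toReal_mono (by simp) hq.out
    simpa using this
  rw [Measure.restrict_apply_univ, Real.volume_Ico, sub_zero, smul_eq_mul, mul_assoc,
    ← ENNReal.rpow_add_of_nonneg, mul_comm]
  · simp
  · rw [sub_nonneg, div_le_one (by linarith)]
    exact hq1
  · positivity

/-- Solutions are chosen arbitrarily; `hκ` applied to a difference of solutions shows that αu' + AU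
depends, up to null sets, only on the class of g, and this gives linearity. The case (1, 0) yields
the derivative operator, the case (0, A) the perturbation term. -/
lemma ZeroMaxReg.exists_clm [Fact (1 ≤ ENNReal.ofReal p)] (h : ZeroMaxReg ι p K T B) (α : ℂ)
    (A : E₁ →L[ℂ] E₀) (κ : NNReal)
    (hκ : ∀ g U f, IsZeroSolution ι p T B g U f →
      eLpNorm (fun t => α • f t + A (U t)) (ENNReal.ofReal p) (volume.restrict (Ico 0 T)) ≤
        κ * eLpNorm g (ENNReal.ofReal p) (volume.restrict (Ico 0 T))) :
    ∃ N : Lp E₀ (ENNReal.ofReal p) (volume.restrict (Ico 0 T)) →L[ℂ]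
        Lp E₀ (ENNReal.ofReal p) (volume.restrict (Ico 0 T)), ‖N‖ ≤ κ ∧
      ∀ g U f (hs : IsZeroSolution ι p T B g U f),
        N (hs.memLp_data.toLp g) =ᵐ[volume.restrict (Ico 0 T)] fun t => α • f t + A (U t) := by
  have hmem : ∀ {g U f}, IsZeroSolution ι p T B g U f →
      MemLp (fun t => α • f t + A (U t)) (ENNReal.ofReal p) (volume.restrict (Ico 0 T)) :=
    fun hs => (hs.memLp_deriv.const_smul α).add (A.comp_memLp' hs.memLp)
  have huniq : ∀ {g U f g' U' f'}, IsZeroSolution ι p T B g U f →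
      IsZeroSolution ι p T B g' U' f' → g =ᵐ[volume.restrict (Ico 0 T)] g' →
      (fun t => α • f t + A (U t)) =ᵐ[volume.restrict (Ico 0 T)]
        fun t => α • f' t + A (U' t) := by
    intro g U f g' U' f' hs hs' hg
    have hd := hs.sub hs'
    have h1 := hκ _ _ _ hd
    have h0 : g - g' =ᵐ[volume.restrict (Ico 0 T)] 0 := by
      filter_upwards [hg] with t ht
      simp [ht]
    rw [eLpNorm_congr_ae h0, eLpNorm_zero, mul_zero, nonpos_iff_eq_zero,
      eLpNorm_eq_zero_iff (hmem hd).1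
        (one_pos.trans_le (Fact.out : 1 ≤ ENNReal.ofReal p)).ne'] at h1
    filter_upwards [h1] with t ht
    rw [← sub_eq_zero]
    simp only [Pi.sub_apply, map_sub, smul_sub, Pi.zero_apply] at ht
    rw [← ht]
    abel
  choose U f hs using fun x : Lp E₀ (ENNReal.ofReal p) (volume.restrict (Ico 0 T)) =>
    h.exists_sol x (Lp.memLp x)
  let N₀ : Lp E₀ (ENNReal.ofReal p) (volume.restrict (Ico 0 T)) →ₗ[ℂ]
      Lp E₀ (ENNReal.ofReal p) (volume.restrict (Ico 0 T)) :=
    { toFun := fun x => (hmem (hs x)).toLp _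
      map_add' := by
        intro x y
        rw [← MemLp.toLp_add, MemLp.toLp_eq_toLp_iff]
        refine (huniq (hs (x + y)) ((hs x).add (hs y)) (Lp.coeFn_add x y)).trans
          (.of_forall fun t => ?_)
        simp only [Pi.add_apply, map_add, smul_add]
        abel
      map_smul' := by
        intro c x
        rw [RingHom.id_apply, ← MemLp.toLp_const_smul, MemLp.toLp_eq_toLp_iff]
        refine (huniq (hs (c • x)) ((hs x).const_smul c) (Lp.coeFn_smul c x)).trans
          (.of_forall fun t => ?_)
        simp only [Pi.smul_apply, map_smul, smul_add, smul_comm α c] }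
  refine ⟨N₀.mkContinuous κ fun x => ?_, N₀.mkContinuous_norm_le κ.2 _, fun g V k hg => ?_⟩
  · have h1 := hκ _ _ _ (hs x)
    change ‖(hmem (hs x)).toLp _‖ ≤ _
    rw [Lp.norm_toLp, Lp.norm_def]
    have := ENNReal.toReal_mono (ENNReal.mul_ne_top (by simp) (Lp.memLp x).2.ne) h1
    rwa [ENNReal.toReal_mul, ENNReal.coe_toReal] at this
  · change ((hmem (hs _)).toLp _ : ℝ → E₀) =ᵐ[_] _
    refine (MemLp.coeFn_toLp _).trans (huniq (hs _) hg (MemLp.coeFn_toLp _))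

/-- The operator mapping the data to the derivative of the solution. -/
lemma ZeroMaxReg.exists_derivOp [Fact (1 ≤ ENNReal.ofReal p)] (h : ZeroMaxReg ι p K T B) :
    ∃ P : Lp E₀ (ENNReal.ofReal p) (volume.restrict (Ico 0 T)) →L[ℂ]
        Lp E₀ (ENNReal.ofReal p) (volume.restrict (Ico 0 T)), ‖P‖ ≤ K ∧
      ∀ g U f (hs : IsZeroSolution ι p T B g U f),
        P (hs.memLp_data.toLp g) =ᵐ[volume.restrict (Ico 0 T)] f := by
  obtain ⟨P, hP, h1⟩ := h.exists_clm 1 0 K (by simpa using h.bound)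
  exact ⟨P, hP, fun g U f hs => (h1 g U f hs).trans (.of_forall fun t => by simp)⟩

lemma IsZeroSolution.of_add {A : E₁ →L[ℂ] E₀} {g : ℝ → E₀} {U : ℝ → E₁} {f : ℝ → E₀}
    (hs : IsZeroSolution ι p T (B + A) g U f) :
    IsZeroSolution ι p T B (fun t => g t + A (U t)) U f :=
  ⟨hs.memLp, hs.memLp_deriv, hs.ae_eq, by
    filter_upwards [hs.equation] with t ht
    rw [← ht, add_apply]
    abel⟩

lemma IsZeroSolution.to_add {A : E₁ →L[ℂ] E₀} {g h : ℝ → E₀} {U : ℝ → E₁} {f : ℝ → E₀}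
    (hs : IsZeroSolution ι p T B h U f)
    (hg : ∀ᵐ t ∂volume.restrict (Ico 0 T), h t - A (U t) = g t) :
    IsZeroSolution ι p T (B + A) g U f :=
  ⟨hs.memLp, hs.memLp_deriv, hs.ae_eq, by
    filter_upwards [hs.equation, hg] with t ht ht'
    rw [← ht', ← ht, add_apply]
    abel⟩

lemma ZeroMaxReg.eLpNorm_relBounded_le [hq : Fact (1 ≤ ENNReal.ofReal p)]
    (h : ZeroMaxReg ι p K T B) (hT : 0 ≤ T) {A : E₁ →L[ℂ] E₀} {δ C : ℝ} (hδ : 0 ≤ δ) (hC : 0 ≤ C)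
    (hA : ∀ u, ‖A u‖ ≤ δ * ‖B u‖ + C * ‖ι u‖) (hsmall : δ * (K + 1) + C * (T * K) ≤ 1 / 2)
    {g : ℝ → E₀} {U : ℝ → E₁} {f : ℝ → E₀} (hs : IsZeroSolution ι p T B g U f) :
    eLpNorm (fun t => A (U t)) (ENNReal.ofReal p) (volume.restrict (Ico 0 T)) ≤
      ((1 / 2 : NNReal) : ℝ≥0∞) * eLpNorm g (ENNReal.ofReal p) (volume.restrict (Ico 0 T)) := by
  set G := eLpNorm g (ENNReal.ofReal p) (volume.restrict (Ico 0 T))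
  have hBU := B.comp_memLp' hs.memLp
  have hιU := ι.comp_memLp' hs.memLp
  have h1 := h.bound _ _ _ hs
  have h2 : eLpNorm (fun t => B (U t)) (ENNReal.ofReal p) (volume.restrict (Ico 0 T)) ≤
      K * G + G := by
    have e : (fun t => B (U t)) =ᵐ[volume.restrict (Ico 0 T)] f - g := by
      filter_upwards [hs.equation] with t ht
      rw [Pi.sub_apply, ← ht]
      abel
    rw [eLpNorm_congr_ae e]
    exact (eLpNorm_sub_le hs.memLp_deriv.1 hs.memLp_data.1 hq.out).trans (by gcongr)
  have h3 : eLpNorm (fun t => ι (U t)) (ENNReal.ofReal p) (volume.restrict (Ico 0 T)) ≤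
      ENNReal.ofReal T * (K * G) := by
    rw [eLpNorm_congr_ae hs.ae_eq]
    exact (eLpNorm_integral_le hs.memLp_deriv).trans (by gcongr)
  have h4 : eLpNorm (fun t => A (U t)) (ENNReal.ofReal p) (volume.restrict (Ico 0 T)) ≤
      eLpNorm ((fun t => δ * ‖B (U t)‖) + fun t => C * ‖ι (U t)‖) (ENNReal.ofReal p)
        (volume.restrict (Ico 0 T)) :=
    eLpNorm_mono_real fun t => hA (U t)
  refine h4.trans ((eLpNorm_add_le (hBU.norm.const_mul δ).1 (hιU.norm.const_mul C).1
    hq.out).trans ?_)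
  have e1 := eLpNorm_const_smul (μ := volume.restrict (Ico 0 T)) δ
    (fun t => ‖B (U t)‖) (ENNReal.ofReal p)
  have e2 := eLpNorm_const_smul (μ := volume.restrict (Ico 0 T)) C
    (fun t => ‖ι (U t)‖) (ENNReal.ofReal p)
  rw [eLpNorm_norm, Real.enorm_eq_ofReal hδ] at e1
  rw [eLpNorm_norm, Real.enorm_eq_ofReal hC] at e2
  change eLpNorm (δ • fun t => ‖B (U t)‖) _ _ + eLpNorm (C • fun t => ‖ι (U t)‖) _ _ ≤ _
  rw [e1, e2]
  calc _ ≤ ENNReal.ofReal δ * (K * G + G) + ENNReal.ofReal C * (ENNReal.ofReal T * (K * G)) := by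
        gcongr
    _ = ENNReal.ofReal (δ * (K + 1) + C * (T * K)) * G := by
        rw [ENNReal.ofReal_add (by positivity) (by positivity), ENNReal.ofReal_mul hδ,
          ENNReal.ofReal_mul hC, ENNReal.ofReal_mul hT,
          ENNReal.ofReal_add (by positivity) one_pos.le, ENNReal.ofReal_coe_nnreal,
          ENNReal.ofReal_one]
        ring
    _ ≤ _ := by
        gcongr
        rw [← ENNReal.ofReal_coe_nnreal]
        exact ENNReal.ofReal_le_ofReal (by simpa using hsmall)

/-- Let N send data h to AU, with U the solution for B and h; then ‖N‖ ≤ 1/2. Solving for B with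
data x = (1 - N)⁻¹g gives u' - Bu - Au = x - Nx = g. Conversely, the data H = g + Au of any solution
satisfy ‖H‖ ≤ ‖g‖ + ‖H‖/2, so K becomes 2K. -/
lemma ZeroMaxReg.add_relBounded [hq : Fact (1 ≤ ENNReal.ofReal p)] [CompleteSpace E₀]
    (h : ZeroMaxReg ι p K T B) (hT : 0 ≤ T) {A : E₁ →L[ℂ] E₀} {δ C : ℝ} (hδ : 0 ≤ δ) (hC : 0 ≤ C)
    (hA : ∀ u, ‖A u‖ ≤ δ * ‖B u‖ + C * ‖ι u‖) (hsmall : δ * (K + 1) + C * (T * K) ≤ 1 / 2) :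
    ZeroMaxReg ι p (2 * K) T (B + A) where
  exists_sol g hg := by
    obtain ⟨N, hN, hN'⟩ := h.exists_clm 0 A (1 / 2) fun g U f hs => by
      simpa using h.eLpNorm_relBounded_le hT hδ hC hA hsmall hs
    have hu : IsUnit (1 - N) := isUnit_one_sub_of_norm_lt_one
      (hN.trans_lt (by norm_num))
    obtain ⟨v, hv⟩ := hu
    set x := (v⁻¹).1 (hg.toLp g)
    have hx : x - N x = hg.toLp g := by
      have : (v.1 * (v⁻¹).1) (hg.toLp g) = hg.toLp g := by simp
      rwa [hv] at this
    obtain ⟨U, f, hs⟩ := h.exists_sol x (Lp.memLp x)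
    refine ⟨U, f, hs.to_add ?_⟩
    have h1 := hN' _ _ _ hs
    rw [Lp.toLp_coeFn] at h1
    have h2 := Lp.coeFn_sub x (N x)
    rw [hx] at h2
    filter_upwards [h1, h2, hg.coeFn_toLp] with t h1 h2 h3
    rw [← h3, h2, Pi.sub_apply, h1, zero_smul, zero_add]
  bound g U f hs := by
    have hs' := hs.of_add
    have h1 := h.eLpNorm_relBounded_le hT hδ hC hA hsmall hs'
    have h2 := h.bound _ _ _ hs'
    set H := eLpNorm (fun t => g t + A (U t)) (ENNReal.ofReal p) (volume.restrict (Ico 0 T))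
    set G := eLpNorm g (ENNReal.ofReal p) (volume.restrict (Ico 0 T))
    -- Finiteness is needed to absorb H/2 into the left side.
    have hH : H ≠ ∞ := hs'.memLp_data.2.ne
    have h3 : H ≤ G + ((1 / 2 : NNReal) : ℝ≥0∞) * H :=
      (eLpNorm_add_le hs.memLp_data.1 (A.comp_memLp' hs.memLp).1 hq.out).trans
        (add_le_add_right h1 _)
    have hG : G ≠ ∞ := hs.memLp_data.2.ne
    have h4 : H ≤ 2 * G := by
      clear_value H G
      lift H to NNReal using hH
      lift G to NNReal using hG
      norm_cast at h3 ⊢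
      rw [← NNReal.coe_le_coe] at h3 ⊢
      push_cast at h3 ⊢
      linarith
    refine h2.trans ?_
    push_cast
    calc (K : ℝ≥0∞) * H ≤ K * (2 * G) := by gcongr
      _ = 2 * K * G := by ring

end SolutionOperator

/-! ### The semigroup operators -/

section Semigroup

variable {E₀ E₁ : Type*} [NormedAddCommGroup E₀] [NormedSpace ℂ E₀]
  [NormedAddCommGroup E₁] [NormedSpace ℂ E₁]
  {ι : E₁ →L[ℂ] E₀} {p T : ℝ} {B : E₁ →L[ℂ] E₀} {K : NNReal}

/-- `L^p((0, 1) → F)`. -/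
abbrev UnitLp (F : Type*) [NormedAddCommGroup F] (p : ℝ) : Type _ :=
  Lp F (ENNReal.ofReal p) (volume.restrict (Ico (0 : ℝ) 1))

/-- `P` maps the data of the zero initial value problem on `[0, 1)` to the derivative of the
solution. -/
structure IsDerivOp [Fact (1 ≤ ENNReal.ofReal p)] (ι B : E₁ →L[ℂ] E₀)
    (P : UnitLp E₀ p →L[ℂ] UnitLp E₀ p) : Prop where
  reg : ∃ K, ZeroMaxReg ι p K 1 B
  ae_eq : ∀ {g U f} (hs : IsZeroSolution ι p 1 B g U f),
    P (hs.memLp_data.toLp g) =ᵐ[volume.restrict (Ico (0 : ℝ) 1)] f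

/-! ### Integration and constants as bounded operators on the unit interval. -/

section UnitIntegral

lemma norm_integral_le_norm [Fact (1 ≤ ENNReal.ofReal p)] (f : UnitLp E₀ p) {t : ℝ}
    (ht : t ∈ Icc (0 : ℝ) 1) : ‖∫ s in (0 : ℝ)..t, f s‖ ≤ ‖f‖ := by
  have h1 := enorm_integral_le_eLpNorm (Lp.memLp f) ht
  rw [ENNReal.ofReal_one, ENNReal.one_rpow, mul_one] at h1
  rw [Lp.norm_def, ← toReal_enorm]
  exact ENNReal.toReal_mono (Lp.memLp f).2.ne h1

/-- Integration over `(0, 1)`. -/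
noncomputable def unitIntegral (E₀ : Type*) [NormedAddCommGroup E₀] [NormedSpace ℂ E₀] (p : ℝ)
    [Fact (1 ≤ ENNReal.ofReal p)] : UnitLp E₀ p →L[ℂ] E₀ :=
  LinearMap.mkContinuous
    { toFun := fun f => ∫ s in (0 : ℝ)..1, f s
      map_add' := fun f g => by
        have h0 : (0 : ℝ) ∈ Icc (0 : ℝ) 1 := by simp
        have h1 : (1 : ℝ) ∈ Icc (0 : ℝ) 1 := by simp
        rw [intervalIntegral_congr_of_ae (Lp.coeFn_add f g) h0 h1]
        exact intervalIntegral.integral_add (intervalIntegrable_of_memLp (Lp.memLp f) h0 h1)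
          (intervalIntegrable_of_memLp (Lp.memLp g) h0 h1)
      map_smul' := fun c f => by
        rw [intervalIntegral_congr_of_ae (Lp.coeFn_smul c f) (by simp) (by simp)]
        exact intervalIntegral.integral_smul c _ } 1
    fun f => by simpa using norm_integral_le_norm f (t := 1) (by simp)

lemma unitIntegral_apply [Fact (1 ≤ ENNReal.ofReal p)] (f : UnitLp E₀ p) :
    unitIntegral E₀ p f = ∫ s in (0 : ℝ)..1, f s := rfl

lemma norm_unitIntegral_le [Fact (1 ≤ ENNReal.ofReal p)] : ‖unitIntegral E₀ p‖ ≤ 1 :=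
  LinearMap.mkContinuous_norm_le _ one_pos.le _

/-- Constant functions on `(0, 1)`. -/
noncomputable def unitConst (E₀ : Type*) [NormedAddCommGroup E₀] [NormedSpace ℂ E₀] (p : ℝ)
    [Fact (1 ≤ ENNReal.ofReal p)] : E₀ →L[ℂ] UnitLp E₀ p :=
  Lp.constL (ENNReal.ofReal p) (volume.restrict (Ico (0 : ℝ) 1)) ℂ

lemma norm_unitConst_le [Fact (1 ≤ ENNReal.ofReal p)] : ‖unitConst E₀ p‖ ≤ 1 :=
  (Lp.norm_constL_le _ _ _).trans (by simp [Measure.real])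

lemma coeFn_unitConst [Fact (1 ≤ ENNReal.ofReal p)] (x : E₀) :
    unitConst E₀ p x =ᵐ[volume.restrict (Ico (0 : ℝ) 1)] fun _ => x :=
  Lp.coeFn_const _ _ _

end UnitIntegral

lemma ZeroMaxReg.exists_isDerivOp [Fact (1 ≤ ENNReal.ofReal p)] (h : ZeroMaxReg ι p K 1 B) :
    ∃ P : UnitLp E₀ p →L[ℂ] UnitLp E₀ p, ‖P‖ ≤ K ∧ IsDerivOp ι B P := by
  obtain ⟨P, hP, h1⟩ := h.exists_derivOp
  exact ⟨P, hP, ⟨K, h⟩, fun hs => h1 _ _ _ hs⟩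

/-! ### Dependence of the derivative operator on a scalar factor of B. -/

namespace IsDerivOp

variable [Fact (1 ≤ ENNReal.ofReal p)] {P : UnitLp E₀ p →L[ℂ] UnitLp E₀ p}

lemma exists_sol (hP : IsDerivOp ι B P) (x : UnitLp E₀ p) :
    ∃ U, IsZeroSolution ι p 1 B x U (P x) := by
  obtain ⟨K, h⟩ := hP.reg
  obtain ⟨U, f, hs⟩ := h.exists_sol x (Lp.memLp x)
  have := hP.ae_eq hs
  rw [Lp.toLp_coeFn] at this
  exact ⟨U, hs.congr_deriv this.symm⟩

lemma exists_sol_const (hP : IsDerivOp ι B P) (x : E₀) :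
    ∃ U, IsZeroSolution ι p 1 B (fun _ => x) U (P (unitConst E₀ p x)) := by
  obtain ⟨U, hU⟩ := hP.exists_sol (unitConst E₀ p x)
  exact ⟨U, hU.congr_data (coeFn_unitConst x)⟩

lemma ae_eq_const (hP : IsDerivOp ι B P) {x : E₀} {U : ℝ → E₁} {f : ℝ → E₀}
    (hs : IsZeroSolution ι p 1 B (fun _ => x) U f) :
    P (unitConst E₀ p x) =ᵐ[volume.restrict (Ico (0 : ℝ) 1)] f :=
  hP.ae_eq hs

/-- If u solves the problem for zB with data x, then Bu = z⁻¹(Px - x), so the same u solves the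
problem for z'B with data x - (z' - z)Bu. -/
lemma resolvent_identity {z z' : ℂ} {P' : UnitLp E₀ p →L[ℂ] UnitLp E₀ p} (hz : z ≠ 0)
    (hP : IsDerivOp ι (z • B) P) (hP' : IsDerivOp ι (z' • B) P') :
    P' * (1 - (z' - z) • z⁻¹ • (P - 1)) = P := by
  ext1 x
  obtain ⟨U, hU⟩ := hP.exists_sol x
  set y : UnitLp E₀ p := x - (z' - z) • z⁻¹ • (P x - x)
  have hy : IsZeroSolution ι p 1 (z' • B) y U (P x) := by
    refine ⟨hU.memLp, hU.memLp_deriv, hU.ae_eq, ?_⟩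
    filter_upwards [hU.equation, Lp.coeFn_sub x ((z' - z) • z⁻¹ • (P x - x)),
      Lp.coeFn_smul (z' - z) (z⁻¹ • (P x - x)), Lp.coeFn_smul z⁻¹ (P x - x),
      Lp.coeFn_sub (P x) x] with t h1 h2 h3 h4 h5
    rw [h2, Pi.sub_apply, h3, Pi.smul_apply, h4, Pi.smul_apply, h5, Pi.sub_apply]
    rw [smul_apply] at h1 ⊢
    have h6 : P x t - x t = z • B (U t) := by rw [← h1]; abel
    rw [h6, smul_smul z⁻¹, inv_mul_cancel₀ hz, one_smul, ← h1, sub_smul]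
    abel
  have h1 := hP'.ae_eq hy
  rw [Lp.toLp_coeFn] at h1
  exact Lp.ext h1

/-- Near z the resolvent identity can be inverted: P(z') = P(z)(1 - (z' - z)Q)⁻¹. -/
lemma hasDerivAt [CompleteSpace E₀] {z : ℂ} {P : ℂ → UnitLp E₀ p →L[ℂ] UnitLp E₀ p} (hz : z ≠ 0)
    (hP : ∀ᶠ z' in 𝓝 z, IsDerivOp ι (z' • B) (P z')) :
    HasDerivAt P (P z * (z⁻¹ • (P z - 1))) z := by
  set Q := z⁻¹ • (P z - 1)
  have hlin : HasDerivAt (fun z' : ℂ => 1 - (z' - z) • Q) (-Q) z := by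
    have := (((hasDerivAt_id z).sub_const z).smul_const Q).const_sub 1
    simpa using this
  have hinv : HasDerivAt (fun z' : ℂ => Ring.inverse (1 - (z' - z) • Q)) Q z := by
    have h1 := hasFDerivAt_ringInverse (𝕜 := ℂ) (1 : (UnitLp E₀ p →L[ℂ] UnitLp E₀ p)ˣ)
    have h2 : ((1 : (UnitLp E₀ p →L[ℂ] UnitLp E₀ p)ˣ) : UnitLp E₀ p →L[ℂ] UnitLp E₀ p) =
        1 - (z - z) • Q := by simp
    rw [h2] at h1
    have h3 := h1.comp_hasDerivAt z hlin
    simpa [Function.comp_def] using h3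
  have hunit : ∀ᶠ z' in 𝓝 z, IsUnit (1 - (z' - z) • Q) := by
    have : Tendsto (fun z' : ℂ => 1 - (z' - z) • Q) (𝓝 z) (𝓝 1) := by
      simpa using hlin.continuousAt.tendsto
    exact this (Units.isOpen.mem_nhds isUnit_one)
  have hmul := (hinv.const_mul (P z))
  refine hmul.congr_of_eventuallyEq ?_
  filter_upwards [hP, hunit] with z' h1 h2
  rw [← resolvent_identity hz hP.self_of_nhds h1, mul_assoc, Ring.mul_inverse_cancel _ h2, mul_one]

/-- By time scaling and uniqueness, the orbit for tB is the orbit for B run at speed t. -/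
lemma smul_unitIntegral (hP : IsDerivOp ι B P) {P' : UnitLp E₀ p →L[ℂ] UnitLp E₀ p} {t : ℝ}
    (ht : 0 < t) (ht1 : t ≤ 1) (hP' : IsDerivOp ι ((t : ℂ) • B) P') (x : E₀) :
    (t : ℂ) • unitIntegral E₀ p (P' (unitConst E₀ p x)) =
      ∫ s in (0 : ℝ)..t, P (unitConst E₀ p x) s := by
  obtain ⟨U, hU⟩ := hP.exists_sol_const x
  have h1 := (hU.restrict ht1).rescale ht
  rw [div_self ht.ne'] at h1
  have h2 := hP'.ae_eq_const h1
  rw [← map_smul, ← map_smul, ← map_smul, unitIntegral_apply,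
    intervalIntegral_congr_of_ae h2 (by simp) (by simp), intervalIntegral.integral_smul,
    Complex.coe_smul, intervalIntegral.smul_integral_comp_mul_left, mul_zero, mul_one]

lemma memLp_primitive {F : Type*} [NormedAddCommGroup F] [NormedSpace ℂ F] {f : ℝ → F}
    (hf : MemLp f (ENNReal.ofReal p) (volume.restrict (Ico (0 : ℝ) 1))) :
    MemLp (fun t => ∫ s in (0 : ℝ)..t, f s) (ENNReal.ofReal p)
      (volume.restrict (Ico (0 : ℝ) 1)) := by
  have hf' := intervalIntegrable_of_memLp hf (a := 0) (b := 1) (by simp) (by simp)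
  have hc : ContinuousOn (fun t => ∫ s in (0 : ℝ)..t, f s) (Icc 0 1) := by
    have := intervalIntegral.continuousOn_primitive_interval' hf' (a := 0) (by simp)
    rwa [uIcc_of_le zero_le_one] at this
  obtain ⟨C, hC⟩ := isCompact_Icc.exists_bound_of_continuousOn hc
  refine MemLp.of_bound ((hc.mono Ico_subset_Icc_self).aestronglyMeasurable measurableSet_Ico) C ?_
  filter_upwards [ae_restrict_mem measurableSet_Ico] with t ht
  exact hC t ⟨ht.1, ht.2.le⟩

/-- This is e^{tB}w = w + ∫₀ᵗ e^{sB}Bw ds. If Y solves the problem with data Bw, then integrating w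
+ Y in E₁ produces the solution with data ιw, and its derivative is the right-hand side. -/
lemma ae_eq_of_domain [CompleteSpace E₀] [CompleteSpace E₁] (hP : IsDerivOp ι B P) (w : E₁) :
    P (unitConst E₀ p (ι w)) =ᵐ[volume.restrict (Ico (0 : ℝ) 1)]
      fun t => ι w + ∫ s in (0 : ℝ)..t, P (unitConst E₀ p (B w)) s := by
  obtain ⟨Y, hY⟩ := hP.exists_sol_const (B w)
  have hint : ∀ t ∈ Ico (0 : ℝ) 1, IntervalIntegrable Y volume 0 t := fun t ht =>
    intervalIntegrable_of_memLp hY.memLp (by simp) ⟨ht.1, ht.2.le⟩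
  refine hP.ae_eq_const (U := fun t => ∫ s in (0 : ℝ)..t, (w + Y s)) ⟨?_, ?_, ?_, ?_⟩
  · exact memLp_primitive ((memLp_const w).add hY.memLp)
  · have h1 : MemLp (fun _ : ℝ => ι w) (ENNReal.ofReal p) (volume.restrict (Ico (0 : ℝ) 1)) :=
      memLp_const _
    exact h1.add (memLp_primitive hY.memLp_deriv)
  · filter_upwards [ae_restrict_mem measurableSet_Ico] with t ht
    rw [← ι.intervalIntegral_comp_comm (intervalIntegrable_const.add (hint t ht))]
    refine intervalIntegral_congr_of_ae ?_ (by simp) ⟨ht.1, ht.2.le⟩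
    filter_upwards [hY.ae_eq] with s hs
    rw [map_add, hs]
  · filter_upwards [ae_restrict_mem measurableSet_Ico] with t ht
    rw [← B.intervalIntegral_comp_comm (intervalIntegrable_const.add (hint t ht)),
      sub_eq_iff_eq_add, add_right_inj]
    refine intervalIntegral_congr_of_ae ?_ (by simp) ⟨ht.1, ht.2.le⟩
    filter_upwards [hY.equation] with s hs
    rw [map_add]
    exact sub_eq_iff_eq_add.1 hs

end IsDerivOp

/-- The time-one mean value operator `x ↦ ∫₀¹ e^{sB} x ds`, expressed through `P`. -/
noncomputable def meanOp [Fact (1 ≤ ENNReal.ofReal p)] (P : UnitLp E₀ p →L[ℂ] UnitLp E₀ p) : E₀ →L[ℂ] E₀ :=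
  unitIntegral E₀ p ∘L P ∘L unitConst E₀ p

/-- The time-one operator `e^B`, expressed through `P`. -/
noncomputable def expOp [Fact (1 ≤ ENNReal.ofReal p)] (P : UnitLp E₀ p →L[ℂ] UnitLp E₀ p) : E₀ →L[ℂ] E₀ :=
  unitIntegral E₀ p ∘L (P * P) ∘L unitConst E₀ p

lemma norm_meanOp_le [Fact (1 ≤ ENNReal.ofReal p)] (P : UnitLp E₀ p →L[ℂ] UnitLp E₀ p) :
    ‖meanOp P‖ ≤ ‖P‖ := by
  calc ‖meanOp P‖ ≤ ‖unitIntegral E₀ p‖ * (‖P‖ * ‖unitConst E₀ p‖) :=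
        (ContinuousLinearMap.opNorm_comp_le _ _).trans
          (by gcongr; exact ContinuousLinearMap.opNorm_comp_le _ _)
    _ ≤ 1 * (‖P‖ * 1) := by gcongr <;> [exact norm_unitIntegral_le; exact norm_unitConst_le]
    _ = ‖P‖ := by ring

lemma norm_expOp_le [Fact (1 ≤ ENNReal.ofReal p)] (P : UnitLp E₀ p →L[ℂ] UnitLp E₀ p) :
    ‖expOp P‖ ≤ ‖P‖ * ‖P‖ :=
  (norm_meanOp_le (P * P)).trans (norm_mul_le _ _)

end Semigroup

/-! ### Sectors -/

section Sector

variable {θ : ℝ}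

lemma mem_openSector_iff (hθ : 0 < θ) (hθ' : θ < Real.pi / 2) {z : ℂ} :
    z ∈ openSector θ ↔ 0 < z.re ∧ |z.im| < Real.tan θ * z.re := by
  have hmem : ∀ φ : ℝ, |φ| < Real.pi / 2 → φ ∈ Ioo (-(Real.pi / 2)) (Real.pi / 2) :=
    fun φ h => abs_lt.1 h
  have key : 0 < z.re → (|z.arg| < θ ↔ |z.im| < Real.tan θ * z.re) := by
    intro hre
    have harg : |z.arg| < Real.pi / 2 := Complex.abs_arg_lt_pi_div_two_iff.2 (Or.inl hre)
    have h1 := (Real.strictMonoOn_tan.lt_iff_lt (hmem _ harg) (hmem θ (by rwa [abs_of_pos hθ])))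
    have h2 := (Real.strictMonoOn_tan.lt_iff_lt
      (hmem (-θ) (by rwa [abs_neg, abs_of_pos hθ])) (hmem _ harg))
    rw [abs_lt, abs_lt, ← h1, ← h2, Complex.tan_arg, Real.tan_neg, lt_div_iff₀ hre,
      div_lt_iff₀ hre, neg_mul]
  constructor
  · rintro ⟨h0, h⟩
    have hre : 0 < z.re :=
      (Complex.abs_arg_lt_pi_div_two_iff.1 (h.trans hθ')).resolve_right h0
    exact ⟨hre, (key hre).1 h⟩
  · rintro ⟨hre, h⟩
    exact ⟨fun h0 => by simp [h0] at hre, (key hre).2 h⟩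

lemma isOpen_openSector (hθ : 0 < θ) (hθ' : θ < Real.pi / 2) : IsOpen (openSector θ) := by
  have : openSector θ = {z : ℂ | 0 < z.re} ∩ {z : ℂ | |z.im| < Real.tan θ * z.re} := by
    ext z
    exact mem_openSector_iff hθ hθ'
  rw [this]
  exact (isOpen_lt (by fun_prop) (by fun_prop)).inter (isOpen_lt (by fun_prop) (by fun_prop))

lemma add_mem_openSector (hθ : 0 < θ) (hθ' : θ < Real.pi / 2) {z w : ℂ} (hz : z ∈ openSector θ)
    (hw : w ∈ openSector θ) : z + w ∈ openSector θ := by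
  rw [mem_openSector_iff hθ hθ'] at *
  refine ⟨add_pos hz.1 hw.1, ?_⟩
  rw [Complex.add_im, Complex.add_re, mul_add]
  exact (abs_add_le _ _).trans_lt (add_lt_add hz.2 hw.2)

lemma smul_mem_openSector {z : ℂ} (hz : z ∈ openSector θ) {t : ℝ} (ht : 0 < t) :
    (t : ℂ) * z ∈ openSector θ :=
  ⟨mul_ne_zero (by simpa using ht.ne') hz.1, by rw [Complex.arg_real_mul z ht]; exact hz.2⟩

lemma convex_openSector (hθ : 0 < θ) (hθ' : θ < Real.pi / 2) : Convex ℝ (openSector θ) := by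
  rw [convex_iff_forall_pos]
  intro z hz w hw a b ha hb _
  exact add_mem_openSector hθ hθ' (by simpa using smul_mem_openSector hz ha)
    (by simpa using smul_mem_openSector hw hb)

lemma ofReal_mem_openSector (hθ : 0 < θ) {t : ℝ} (ht : 0 < t) : (t : ℂ) ∈ openSector θ :=
  ⟨by simpa using ht.ne', by rwa [Complex.arg_ofReal_of_nonneg ht.le, abs_zero]⟩

/-- A set of full measure is dense, even after removing one point. Statements about solutions hold
only at almost every time, so the identity theorem is needed in this form. -/
lemma frequently_nhdsNE_ofReal_of_ae {r : ℝ} (hr : 0 < r) {Q : ℂ → Prop}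
    (h : ∀ᵐ s : ℝ, s ∈ Ioo 0 r → Q s) : ∃ᶠ z in 𝓝[≠] (((r / 2 : ℝ)) : ℂ), Q z := by
  have hne : ∀ᵐ s : ℝ, s ≠ r / 2 := by simp [ae_iff, measure_singleton]
  have hd := Measure.dense_of_ae (hne.and h)
  have h1 : ∃ᶠ s : ℝ in 𝓝 (r / 2), s ≠ r / 2 ∧ (s ∈ Ioo 0 r → Q s) :=
    mem_closure_iff_frequently.1 (hd (r / 2))
  have h2 : ∃ᶠ s : ℝ in 𝓝[≠] (r / 2), Q s := by
    rw [frequently_nhdsWithin_iff]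
    refine (h1.and_eventually (Ioo_mem_nhds (half_pos hr) (half_lt_self hr))).mono ?_
    rintro s ⟨⟨h3, h4⟩, h5⟩
    exact ⟨h4 h5, h3⟩
  have h3 : Tendsto (fun s : ℝ => (s : ℂ)) (𝓝[≠] (r / 2)) (𝓝[≠] (((r / 2 : ℝ)) : ℂ)) := by
    refine tendsto_nhdsWithin_of_tendsto_nhds_of_eventually_within _
      (Complex.continuous_ofReal.continuousAt.tendsto.mono_left nhdsWithin_le_nhds) ?_
    filter_upwards [self_mem_nhdsWithin] with s hs
    exact fun h => hs (Complex.ofReal_injective h)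
  exact h3.frequently h2

/-- Identity theorem on a sector. -/
lemma eqOn_openSector_of_ae {F : Type*} [NormedAddCommGroup F] [NormedSpace ℂ F] [CompleteSpace F]
    (hθ : 0 < θ) (hθ' : θ < Real.pi / 2) {f g : ℂ → F}
    (hf : DifferentiableOn ℂ f (openSector θ)) (hg : DifferentiableOn ℂ g (openSector θ)) {r : ℝ}
    (hr : 0 < r) (h : ∀ᵐ s : ℝ, s ∈ Ioo 0 r → f s = g s) : EqOn f g (openSector θ) :=
  (hf.analyticOnNhd (isOpen_openSector hθ hθ')).eqOn_of_preconnected_of_frequently_eq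
    (hg.analyticOnNhd (isOpen_openSector hθ hθ'))
    (convex_openSector hθ hθ').isPreconnected (ofReal_mem_openSector hθ (half_pos hr))
    (frequently_nhdsNE_ofReal_of_ae (Q := fun z => f z = g z) hr h)

end Sector

/-! ### Generation of a holomorphic semigroup -/

section Generation

variable {E₀ E₁ : Type*} [NormedAddCommGroup E₀] [NormedSpace ℂ E₀] [CompleteSpace E₀]
  [NormedAddCommGroup E₁] [NormedSpace ℂ E₁]
  {ι : E₁ →L[ℂ] E₀} {p : ℝ} {B : E₁ →L[ℂ] E₀} {K : NNReal} [Fact (1 ≤ ENNReal.ofReal p)]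
  {P : ℂ → UnitLp E₀ p →L[ℂ] UnitLp E₀ p} {z : ℂ}

/-- `meanOp` as a bounded linear map. -/
noncomputable def meanOpL (E₀ : Type*) [NormedAddCommGroup E₀] [NormedSpace ℂ E₀] (p : ℝ)
    [Fact (1 ≤ ENNReal.ofReal p)] : (UnitLp E₀ p →L[ℂ] UnitLp E₀ p) →L[ℂ] E₀ →L[ℂ] E₀ :=
  ContinuousLinearMap.compL ℂ E₀ (UnitLp E₀ p) E₀ (unitIntegral E₀ p) ∘L
    (ContinuousLinearMap.compL ℂ E₀ (UnitLp E₀ p) (UnitLp E₀ p)).flip (unitConst E₀ p)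

lemma hasDerivAt_meanOp (hz : z ≠ 0) (hP : ∀ᶠ z' in 𝓝 z, IsDerivOp ι (z' • B) (P z')) :
    HasDerivAt (fun z' => meanOp (P z')) (z⁻¹ • (expOp (P z) - meanOp (P z))) z := by
  have h1 := (meanOpL E₀ p).hasFDerivAt.comp_hasDerivAt z (IsDerivOp.hasDerivAt hz hP)
  rw [mul_smul_comm, mul_sub, mul_one, map_smul, map_sub] at h1
  exact h1

/-- Formally z · `meanOp` is the integral of e^{sB} from 0 to z, so its derivative is e^{zB}. -/
lemma hasDerivAt_smul_meanOp (hz : z ≠ 0) (hP : ∀ᶠ z' in 𝓝 z, IsDerivOp ι (z' • B) (P z')) :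
    HasDerivAt (fun z' => z' • meanOp (P z')) (expOp (P z)) z := by
  have hm := hasDerivAt_meanOp hz hP
  have h := (hasDerivAt_id' z).fun_smul hm
  rw [smul_smul, mul_inv_cancel₀ hz, one_smul, one_smul, sub_add_cancel] at h
  exact h

lemma differentiableAt_expOp (hz : z ≠ 0) (hP : ∀ᶠ z' in 𝓝 z, IsDerivOp ι (z' • B) (P z')) :
    DifferentiableAt ℂ (fun z' => expOp (P z')) z := by
  have h := IsDerivOp.hasDerivAt hz hP
  exact ((meanOpL E₀ p).hasFDerivAt.comp_hasDerivAt z (h.mul h)).differentiableAt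

lemma hasDerivAt_ray (hz : z ≠ 0) {t : ℝ} (ht : t ≠ 0)
    (hP : ∀ᶠ z' in 𝓝 (t * z), IsDerivOp ι (z' • B) (P z')) (x : E₀) :
    HasDerivAt (fun s : ℝ => (s : ℂ) • meanOp (P (s * z)) x) (expOp (P (t * z)) x) t := by
  have h1 := hasDerivAt_smul_meanOp (mul_ne_zero (by simpa using ht) hz) hP
  have h2 : HasDerivAt (fun s : ℝ => (s : ℂ) * z) z t := by
    simpa using Complex.ofRealCLM.hasDerivAt.mul_const z
  have h3 := HasDerivAt.scomp t h1 h2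
  have h4 := ((((ContinuousLinearMap.apply ℂ E₀ x).restrictScalars ℝ).hasFDerivAt.comp_hasDerivAt
    t h3)).const_smul z⁻¹
  refine (h4.congr_of_eventuallyEq (.of_forall fun s => ?_)).congr_deriv ?_
  · simp [smul_smul, mul_comm, hz]
  · simp [smul_smul, hz]

end Generation

/-! ### Strong continuity and the semigroup law. -/

section Generation

variable {E₀ E₁ : Type*} [NormedAddCommGroup E₀] [NormedSpace ℂ E₀]
  [NormedAddCommGroup E₁] [NormedSpace ℂ E₁]
  {ι : E₁ →L[ℂ] E₀} {p : ℝ} {B : E₁ →L[ℂ] E₀} {K : NNReal} [Fact (1 ≤ ENNReal.ofReal p)]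
  {P : ℂ → UnitLp E₀ p →L[ℂ] UnitLp E₀ p} {z : ℂ} {θ : ℝ}

lemma eventually_isDerivOp (hθ : 0 < θ) (hθ' : θ < Real.pi / 2)
    (hP : ∀ z ∈ openSector θ, IsDerivOp ι (z • B) (P z)) (hz : z ∈ openSector θ) :
    ∀ᶠ z' in 𝓝 z, IsDerivOp ι (z' • B) (P z') := by
  filter_upwards [(isOpen_openSector hθ hθ').mem_nhds hz] with z' hz' using hP z' hz'

lemma smul_meanOp_ray (hP : ∀ z ∈ openSector θ, IsDerivOp ι (z • B) (P z))
    (hz : z ∈ openSector θ) {t : ℝ} (ht : t ∈ Ioc (0 : ℝ) 1) (x : E₀) :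
    (t : ℂ) • meanOp (P (t * z)) x = ∫ s in (0 : ℝ)..t, P z (unitConst E₀ p x) s := by
  have h1 := hP _ (smul_mem_openSector hz ht.1)
  rw [← smul_smul] at h1
  exact (hP z hz).smul_unitIntegral ht.1 ht.2 h1 x

/-- Both sides are the derivative at t = 1 of t · `meanOp (P (t * z))` applied to ιw: the left by
the ray formula, the right by integrating the orbit formula for vectors of the domain. -/
lemma expOp_of_domain [CompleteSpace E₀] [CompleteSpace E₁] (hθ : 0 < θ) (hθ' : θ < Real.pi / 2)
    (hP : ∀ z ∈ openSector θ, IsDerivOp ι (z • B) (P z)) (hz : z ∈ openSector θ) (w : E₁) :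
    expOp (P z) (ι w) = ι w + z • meanOp (P z) (B w) := by
  set f : ℝ → E₀ := fun s => P z (unitConst E₀ p ((z • B) w)) s
  -- Extension by zero makes the primitive continuous on the whole line, in particular across t = 1.
  set F : ℝ → E₀ := (Ico (0 : ℝ) 1).indicator f
  have hF : ∀ a b, IntervalIntegrable F volume a b := by
    intro a b
    have : Integrable F volume :=
      IntegrableOn.integrable_indicator ((Lp.memLp _).integrable Fact.out) measurableSet_Ico
    exact this.intervalIntegrable
  have hfF : f =ᵐ[volume.restrict (Ico (0 : ℝ) 1)] F := by
    filter_upwards [ae_restrict_mem measurableSet_Ico] with s hs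
    exact (indicator_of_mem hs f).symm
  set v : ℝ → E₀ := fun t => ι w + ∫ s in (0 : ℝ)..t, F s
  have hv : Continuous v := continuous_const.add (intervalIntegral.continuous_primitive hF 0)
  have hd1 : HasDerivAt (fun t => ∫ s in (0 : ℝ)..t, v s) (v 1) 1 :=
    (hv.integral_hasStrictDerivAt 0 1).hasDerivAt
  have hd2 := hasDerivAt_ray (p := p) hz.1 (one_ne_zero (α := ℝ))
    (by simpa using eventually_isDerivOp hθ hθ' hP hz) (ι w)
  have heq : EqOn (fun t : ℝ => (t : ℂ) • meanOp (P (t * z)) (ι w))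
      (fun t => ∫ s in (0 : ℝ)..t, v s) (Ioc 0 1) := by
    intro t ht
    simp only
    rw [smul_meanOp_ray hP hz ht]
    refine intervalIntegral_congr_of_ae (((hP z hz).ae_eq_of_domain w).trans ?_) (by simp)
      ⟨ht.1.le, ht.2⟩
    filter_upwards [ae_restrict_mem measurableSet_Ico] with s hs
    simp only [v]
    rw [intervalIntegral_congr_of_ae hfF (by simp) ⟨hs.1, hs.2.le⟩]
  -- The formula is available for t ≤ 1 only, so left derivatives are compared.
  have hnear : (fun t : ℝ => (t : ℂ) • meanOp (P (t * z)) (ι w)) =ᶠ[𝓝[≤] 1]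
      fun t => ∫ s in (0 : ℝ)..t, v s := by
    filter_upwards [Ioc_mem_nhdsLE (zero_lt_one (α := ℝ))] with t ht using heq ht
  have hd3 := hd1.hasDerivWithinAt.congr_of_eventuallyEq hnear (heq (by simp))
  have h1 := (uniqueDiffWithinAt_Iic (1 : ℝ)).eq_deriv _ hd2.hasDerivWithinAt hd3
  rw [Complex.ofReal_one, one_mul] at h1
  rw [h1]
  simp only [v]
  rw [← intervalIntegral_congr_of_ae hfF (by simp) (by simp), add_right_inj, ← map_smul]
  rfl

lemma norm_meanOp_sub_le [CompleteSpace E₀] [CompleteSpace E₁]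
    {Q : UnitLp E₀ p →L[ℂ] UnitLp E₀ p} (hQ : IsDerivOp ι B Q) (w : E₁) :
    ‖meanOp Q (ι w) - ι w‖ ≤ ‖Q‖ * ‖B w‖ := by
  have h1 : meanOp Q (ι w) =
      ∫ t in (0 : ℝ)..1, (ι w + ∫ s in (0 : ℝ)..t, Q (unitConst E₀ p (B w)) s) :=
    intervalIntegral_congr_of_ae (hQ.ae_eq_of_domain w) (by simp) (by simp)
  have h2 : ∫ _ in (0 : ℝ)..1, ι w = ι w := by simp
  have h3 : IntervalIntegrable (fun t => ∫ s in (0 : ℝ)..t, Q (unitConst E₀ p (B w)) s)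
      volume 0 1 :=
    intervalIntegrable_of_memLp (IsDerivOp.memLp_primitive (Lp.memLp _)) (by simp) (by simp)
  rw [h1, intervalIntegral.integral_add intervalIntegrable_const h3, h2, add_sub_cancel_left]
  have h4 : ‖∫ t in (0 : ℝ)..1, ∫ s in (0 : ℝ)..t, Q (unitConst E₀ p (B w)) s‖ ≤
      ‖Q (unitConst E₀ p (B w))‖ * |1 - 0| := by
    refine intervalIntegral.norm_integral_le_of_norm_le_const fun t ht => ?_
    rw [uIoc_of_le zero_le_one] at ht
    exact norm_integral_le_norm _ ⟨ht.1.le, ht.2⟩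
  refine h4.trans ?_
  rw [sub_zero, abs_one, mul_one]
  refine (Q.le_opNorm _).trans ?_
  gcongr
  refine ((unitConst E₀ p).le_opNorm _).trans ?_
  exact (mul_le_mul_of_nonneg_right norm_unitConst_le (norm_nonneg _)).trans_eq (one_mul _)

/-- Strong convergence to the identity on a dense subspace extends by boundedness. -/
lemma tendsto_of_denseRange {α : Type*} {l : Filter α} (hdense : DenseRange ι)
    {L : α → E₀ →L[ℂ] E₀} {C : ℝ} (hL : ∀ᶠ a in l, ‖L a‖ ≤ C)
    (h : ∀ w, Tendsto (fun a => L a (ι w)) l (𝓝 (ι w))) (x : E₀) :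
    Tendsto (fun a => L a x) l (𝓝 x) := by
  rw [Metric.tendsto_nhds]
  intro ε hε
  set C' := max C 0
  obtain ⟨w, hw⟩ := hdense.exists_dist_lt x (ε := ε / (2 * (C' + 1))) (by positivity)
  filter_upwards [hL, Metric.tendsto_nhds.1 (h w) (ε / 2) (half_pos hε)] with a ha haw
  have h1 : ‖L a (x - ι w)‖ ≤ C' * dist x (ι w) := by
    rw [dist_eq_norm]
    exact (L a).le_of_opNorm_le (ha.trans (le_max_left _ _)) _
  have e : L a x - x = L a (x - ι w) + (L a (ι w) - ι w) - (x - ι w) := by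
    rw [map_sub]
    abel
  rw [dist_eq_norm] at haw ⊢
  calc ‖L a x - x‖ ≤ ‖L a (x - ι w)‖ + ‖L a (ι w) - ι w‖ + ‖x - ι w‖ := by
        rw [e]
        exact (norm_sub_le _ _).trans (by gcongr; exact norm_add_le _ _)
    _ ≤ C' * dist x (ι w) + ‖L a (ι w) - ι w‖ + dist x (ι w) := by
        rw [← dist_eq_norm x]
        gcongr
    _ = (C' + 1) * dist x (ι w) + ‖L a (ι w) - ι w‖ := by ring
    _ < (C' + 1) * (ε / (2 * (C' + 1))) + ε / 2 := by gcongr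
    _ = ε := by
        have : C' + 1 ≠ 0 := by positivity
        field_simp
        ring

lemma tendsto_expOp_of_denseRange [CompleteSpace E₀] [CompleteSpace E₁] (hdense : DenseRange ι) (hθ : 0 < θ)
    (hθ' : θ < Real.pi / 2) (hP : ∀ z ∈ openSector θ, IsDerivOp ι (z • B) (P z))
    (hK : ∀ z ∈ openSector θ, ‖z‖ ≤ 1 → ‖P z‖ ≤ K) (x : E₀) :
    Tendsto (fun z => expOp (P z) x) (𝓝[openSector θ] 0) (𝓝 x) ∧
      Tendsto (fun z => meanOp (P z) x) (𝓝[openSector θ] 0) (𝓝 x) := by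
  have hev : ∀ᶠ z in 𝓝[openSector θ] (0 : ℂ), ‖P z‖ ≤ K := by
    filter_upwards [self_mem_nhdsWithin,
      nhdsWithin_le_nhds (Metric.closedBall_mem_nhds (0 : ℂ) one_pos)] with z hz hz1
    exact hK z hz (by simpa using hz1)
  have hlim : ∀ w : E₁, Tendsto (fun z : ℂ => K * (‖z‖ * ‖B w‖)) (𝓝[openSector θ] 0) (𝓝 0) := by
    intro w
    have : Continuous fun z : ℂ => K * (‖z‖ * ‖B w‖) := by fun_prop
    have h := this.tendsto 0
    simp only [norm_zero, zero_mul, mul_zero] at h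
    exact h.mono_left nhdsWithin_le_nhds
  constructor
  · refine tendsto_of_denseRange (C := K * K) hdense ?_ (fun w => ?_) x
    · filter_upwards [hev] with z hz
      exact (norm_expOp_le _).trans (by gcongr)
    · rw [tendsto_iff_norm_sub_tendsto_zero]
      refine squeeze_zero' (.of_forall fun _ => norm_nonneg _) ?_ (hlim w)
      filter_upwards [hev, self_mem_nhdsWithin] with z hz hz'
      rw [expOp_of_domain hθ hθ' hP hz', add_sub_cancel_left, ← map_smul, ← norm_smul]
      exact (meanOp (P z)).le_of_opNorm_le ((norm_meanOp_le _).trans hz) _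
  · refine tendsto_of_denseRange (C := K) hdense ?_ (fun w => ?_) x
    · filter_upwards [hev] with z hz
      exact (norm_meanOp_le _).trans hz
    · rw [tendsto_iff_norm_sub_tendsto_zero]
      refine squeeze_zero' (.of_forall fun _ => norm_nonneg _) ?_ (hlim w)
      filter_upwards [hev, self_mem_nhdsWithin] with z hz hz'
      refine (norm_meanOp_sub_le (hP z hz') w).trans ?_
      rw [smul_apply, norm_smul]
      gcongr

/-- The increment of a solution after time `s` solves the problem with data `g(s + ·) + B u(s)`. -/
lemma IsZeroSolution.translate {T s : ℝ} (hs : s ∈ Icc 0 T) {g : ℝ → E₀} {U : ℝ → E₁} {f : ℝ → E₀}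
    (h : IsZeroSolution ι p T B g U f) (hU : ι (U s) = ∫ r in (0 : ℝ)..s, f r) :
    IsZeroSolution ι p (T - s) B (fun t => g (s + t) + B (U s)) (fun t => U (s + t) - U s)
      (fun t => f (s + t)) := by
  have hJ : (fun t : ℝ => 1 * t + s) ⁻¹' Ico s (s + (T - s)) =ᵐ[volume] Ico 0 (T - s) := by
    rw [preimage_add_Ico]; rfl
  have hsub : Ico s (s + (T - s)) ⊆ Ico 0 T := by
    rw [add_sub_cancel]
    exact Ico_subset_Ico_left hs.1
  have hm := (h.memLp.mono_measure (Measure.restrict_mono_set _ hsub)).comp_affine one_ne_zero hJ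
  have hf := (h.memLp_deriv.mono_measure
    (Measure.restrict_mono_set _ hsub)).comp_affine one_ne_zero hJ
  have ha := ae_comp_affine one_ne_zero hJ (ae_restrict_of_ae_restrict_of_subset hsub h.ae_eq)
  have he := ae_comp_affine one_ne_zero hJ (ae_restrict_of_ae_restrict_of_subset hsub h.equation)
  simp only [one_mul, add_comm _ s] at hm hf ha he
  refine ⟨hm.sub (memLp_const _), hf, ?_, ?_⟩
  · filter_upwards [ha, ae_restrict_mem measurableSet_Ico] with t h1 ht
    rw [map_sub, h1, hU, intervalIntegral.integral_comp_add_left, add_zero,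
      intervalIntegral.integral_interval_sub_left]
    all_goals
      refine intervalIntegrable_of_memLp h.memLp_deriv ?_ ?_ <;> constructor <;>
        linarith [ht.1, ht.2, hs.1, hs.2]
  · filter_upwards [he] with t h1
    rw [← h1, map_sub]
    abel

/-- Let Y solve the problem with data Bw. At almost every s the vector e^{sB}w equals ι(w + Y(s)),
hence lies in the domain. The solution translated by s has constant data B(w + Y(s)), and uniqueness
gives the law. -/
lemma expOp_add_of_ae [CompleteSpace E₀] [CompleteSpace E₁] (hθ : 0 < θ)
    (hθ' : θ < Real.pi / 2) (hP : ∀ z ∈ openSector θ, IsDerivOp ι (z • B) (P z)) (w : E₁) :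
    ∀ᵐ s : ℝ, s ∈ Ioo 0 1 → ∀ t : ℝ, t ∈ Ioo 0 (1 - s) →
      expOp (P t) (expOp (P s) (ι w)) = expOp (P (s + t)) (ι w) := by
  have h1 : (1 : ℂ) ∈ openSector θ := by simpa using ofReal_mem_openSector hθ one_pos
  have hP1 := hP 1 h1
  rw [one_smul] at hP1
  obtain ⟨K, hreg⟩ := hP1.reg
  have hformula : ∀ (w : E₁) (t : ℝ), t ∈ Ioc (0 : ℝ) 1 →
      expOp (P t) (ι w) = ι w + ∫ s in (0 : ℝ)..t, P 1 (unitConst E₀ p (B w)) s := by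
    intro w t ht
    rw [expOp_of_domain hθ hθ' hP (ofReal_mem_openSector hθ ht.1)]
    have := smul_meanOp_ray hP h1 ht (B w)
    rw [mul_one] at this
    rw [this]
  obtain ⟨Y, hY⟩ := hP1.exists_sol_const (B w)
  have hae := (ae_restrict_iff' measurableSet_Ico).1 hY.ae_eq
  filter_upwards [hae] with s hs hs01 t ht
  have hYs := hs ⟨hs01.1.le, hs01.2⟩
  have htr := hY.translate ⟨hs01.1.le, hs01.2.le⟩ hYs
  have e1 : expOp (P s) (ι w) = ι (w + Y s) := by
    rw [hformula w s ⟨hs01.1, hs01.2.le⟩, map_add, hYs]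
  obtain ⟨Z, hZ⟩ := hP1.exists_sol_const (B (w + Y s))
  have huniq := (hreg.restrict (by linarith [hs01.1] : 1 - s ≤ 1)).ae_unique htr
    (hZ.restrict (by linarith [hs01.1])) (.of_forall fun t => by simp)
  rw [e1, hformula _ t ⟨ht.1, by linarith [ht.2, hs01.1]⟩, ← Complex.ofReal_add,
    hformula w (s + t) ⟨by linarith [ht.1, hs01.1], by linarith [ht.2]⟩,
    ← intervalIntegral_congr_of_ae huniq ⟨le_rfl, by linarith [hs01.2]⟩ ⟨ht.1.le, ht.2.le⟩,
    intervalIntegral.integral_comp_add_left, map_add, hYs, add_zero, add_assoc,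
    intervalIntegral.integral_add_adjacent_intervals]
  all_goals
    refine intervalIntegrable_of_memLp hY.memLp_deriv ?_ ?_ <;> constructor <;>
      linarith [ht.1, ht.2, hs01.1, hs01.2]

lemma differentiableOn_expOp [CompleteSpace E₀] (hθ : 0 < θ) (hθ' : θ < Real.pi / 2)
    (hP : ∀ z ∈ openSector θ, IsDerivOp ι (z • B) (P z)) :
    DifferentiableOn ℂ (fun z => expOp (P z)) (openSector θ) := fun _ hz =>
  (differentiableAt_expOp hz.1 (eventually_isDerivOp hθ hθ' hP hz)).differentiableWithinAt

/-- The identity theorem is used twice: first in one variable with the other real, then in the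
remaining variable. Density of the domain finishes. -/
lemma expOp_add [CompleteSpace E₀] [CompleteSpace E₁] (hdense : DenseRange ι) (hθ : 0 < θ)
    (hθ' : θ < Real.pi / 2) (hP : ∀ z ∈ openSector θ, IsDerivOp ι (z • B) (P z)) {z₁ z₂ : ℂ}
    (hz₁ : z₁ ∈ openSector θ) (hz₂ : z₂ ∈ openSector θ) :
    expOp (P (z₁ + z₂)) = (expOp (P z₁)).comp (expOp (P z₂)) := by
  have hd := differentiableOn_expOp hθ hθ' hP
  have hshift : ∀ a ∈ openSector θ, ∀ x,
      DifferentiableOn ℂ (fun z => expOp (P (z + a)) x) (openSector θ) := fun a ha x =>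
    ((hd.comp (differentiableOn_id.add_const a)
      fun z hz => add_mem_openSector hθ hθ' hz ha)).clm_apply (differentiableOn_const x)
  have hreal : ∀ (w : E₁) (t : ℝ), t ∈ Ioo (0 : ℝ) 1 → ∀ z ∈ openSector θ,
      expOp (P t) (expOp (P z) (ι w)) = expOp (P (z + t)) (ι w) := by
    intro w t ht
    refine eqOn_openSector_of_ae (r := 1 - t) hθ hθ' ?_
      (hshift t (ofReal_mem_openSector hθ ht.1) (ι w)) (by linarith [ht.2]) ?_
    · exact (differentiableOn_const _).clm_apply (hd.clm_apply (differentiableOn_const _))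
    · filter_upwards [expOp_add_of_ae hθ hθ' hP w] with s hs hs'
      exact hs ⟨hs'.1, by linarith [hs'.2, ht.1]⟩ t ⟨ht.1, by linarith [hs'.2]⟩
  have hcomplex : ∀ w : E₁, expOp (P z₁) (expOp (P z₂) (ι w)) = expOp (P (z₁ + z₂)) (ι w) := by
    intro w
    refine eqOn_openSector_of_ae (r := 1) (f := fun z => expOp (P z) (expOp (P z₂) (ι w)))
      (g := fun z => expOp (P (z + z₂)) (ι w)) hθ hθ'
      (hd.clm_apply (differentiableOn_const _)) (hshift z₂ hz₂ _) one_pos ?_ hz₁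
    refine .of_forall fun t ht => ?_
    rw [hreal w t ht z₂ hz₂, add_comm]
  have := hdense.equalizer (expOp (P (z₁ + z₂))).continuous
    ((expOp (P z₁)).comp (expOp (P z₂))).continuous (funext fun w => (hcomplex w).symm)
  exact DFunLike.coe_injective this

end Generation

/-! ### Closedness of B and identification of the generator. -/

section Generator

variable {E₀ E₁ : Type*} [NormedAddCommGroup E₀] [NormedSpace ℂ E₀]
  [NormedAddCommGroup E₁] [NormedSpace ℂ E₁]
  {ι : E₁ →L[ℂ] E₀} {p : ℝ} {B : E₁ →L[ℂ] E₀} {K : NNReal}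

lemma memLp_ramp {F : Type*} [NormedAddCommGroup F] [NormedSpace ℂ F] (w : F) :
    MemLp (fun t : ℝ => (t : ℂ) • w) (ENNReal.ofReal p) (volume.restrict (Ico (0 : ℝ) 1)) := by
  refine MemLp.of_bound (by fun_prop) ‖w‖ ?_
  filter_upwards [ae_restrict_mem measurableSet_Ico] with t ht
  rw [norm_smul, Complex.norm_real, Real.norm_of_nonneg ht.1]
  exact mul_le_of_le_one_left (norm_nonneg _) ht.2.le

lemma isZeroSolution_ramp [CompleteSpace E₀] (ι B : E₁ →L[ℂ] E₀) (w : E₁) :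
    IsZeroSolution ι p 1 B (fun t => ι w - (t : ℂ) • B w) (fun t => (t : ℂ) • w)
      (fun _ => ι w) where
  memLp := memLp_ramp w
  memLp_deriv := memLp_const _
  ae_eq := .of_forall fun t => by simp
  equation := .of_forall fun t => by simp

variable [Fact (1 ≤ ENNReal.ofReal p)]

/-- Well-posedness implies that `B` is a closed operator. -/
lemma ZeroMaxReg.exists_of_approx [CompleteSpace E₀] (h : ZeroMaxReg ι p K 1 B) {x y : E₀}
    (happ : ∀ ε > 0, ∃ w, ‖ι w - x‖ < ε ∧ ‖B w - y‖ < ε) : ∃ w, ι w = x ∧ B w = y := by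
  have hq : 1 ≤ ENNReal.ofReal p := Fact.out
  -- If ιw = x and Bw = y, then t ↦ tw solves the problem with data x - ty. So this problem is
  -- solved first, its derivative is shown to be the constant x, and w is recovered as U(t)/t at a
  -- good t.
  obtain ⟨U, f, hs⟩ := h.exists_sol (fun t => x - (t : ℂ) • y) ((memLp_const x).sub (memLp_ramp y))
  have hfx : f =ᵐ[volume.restrict (Ico (0 : ℝ) 1)] fun _ => x := by
    have hm := hs.memLp_deriv.sub (memLp_const x)
    -- Comparison with the ramp of an approximating w: the data differ by at most 2ε, which costs
    -- 2Kε, and ιw differs from x by at most ε.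
    have hle : ∀ ε : NNReal, 0 < ε → eLpNorm (f - fun _ => x) (ENNReal.ofReal p)
        (volume.restrict (Ico (0 : ℝ) 1)) ≤ (2 * K + 1) * ε := by
      intro ε hε
      obtain ⟨w, hw1, hw2⟩ := happ ε hε
      have hd := hs.sub (isZeroSolution_ramp ι B w)
      have b1 := h.bound _ _ _ hd
      have b2 : eLpNorm ((fun t : ℝ => x - (t : ℂ) • y) - fun t : ℝ => ι w - (t : ℂ) • B w)
          (ENNReal.ofReal p) (volume.restrict (Ico (0 : ℝ) 1)) ≤ ENNReal.ofReal (2 * ε) := by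
        refine (eLpNorm_le_of_ae_bound (C := 2 * ε) ?_).trans (by simp)
        filter_upwards [ae_restrict_mem measurableSet_Ico] with t ht
        have e : ((fun t : ℝ => x - (t : ℂ) • y) - fun t : ℝ => ι w - (t : ℂ) • B w) t =
            (t : ℂ) • (B w - y) - (ι w - x) := by
          simp only [Pi.sub_apply, smul_sub]
          abel
        rw [e]
        refine (norm_sub_le _ _).trans ?_
        rw [norm_smul, Complex.norm_real, Real.norm_of_nonneg ht.1]
        nlinarith [norm_nonneg (B w - y), ht.2, ht.1]
      have b3 : eLpNorm (fun _ : ℝ => ι w - x) (ENNReal.ofReal p)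
          (volume.restrict (Ico (0 : ℝ) 1)) ≤ ENNReal.ofReal ε :=
        (eLpNorm_le_of_ae_bound (C := ε) (.of_forall fun _ => hw1.le)).trans (by simp)
      have e : (f - fun _ => x) = (f - fun _ => ι w) + fun _ => ι w - x := by
        ext t
        simp
      rw [e]
      refine (eLpNorm_add_le hd.memLp_deriv.1 (by fun_prop) hq).trans
        ((add_le_add (b1.trans (mul_le_mul' le_rfl b2)) b3).trans_eq ?_)
      rw [ENNReal.ofReal_mul (by norm_num), ENNReal.ofReal_coe_nnreal]
      simp
      ring
    have h0 : eLpNorm (f - fun _ => x) (ENNReal.ofReal p)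
        (volume.restrict (Ico (0 : ℝ) 1)) = 0 := by
      refine le_antisymm (ENNReal.le_of_forall_pos_le_add fun ε hε _ => ?_) zero_le
      refine (hle (ε / (2 * K + 1)) (by positivity)).trans_eq ?_
      rw [zero_add]
      norm_cast
      field_simp
    filter_upwards [(eLpNorm_eq_zero_iff hm.1 (one_pos.trans_le hq).ne').1 h0] with t ht
    exact sub_eq_zero.1 ht
  have hgood : ∀ᵐ t ∂volume.restrict (Ico (0 : ℝ) 1),
      0 < t ∧ ι (U t) = (t : ℂ) • x ∧ B (U t) = (t : ℂ) • y := by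
    have hne : ∀ᵐ t ∂volume.restrict (Ico (0 : ℝ) 1), t ≠ 0 :=
      ae_restrict_of_ae (by simp [ae_iff, measure_singleton])
    filter_upwards [hs.ae_eq, hs.equation, hfx, ae_restrict_mem measurableSet_Ico, hne]
      with t h1 h2 h3 ht h4
    refine ⟨lt_of_le_of_ne ht.1 (Ne.symm h4), ?_, ?_⟩
    · rw [h1, intervalIntegral_congr_of_ae hfx (by simp) ⟨ht.1, ht.2.le⟩]
      simp
    · rw [h3] at h2
      exact sub_right_inj.1 h2
  have hnb : (ae (volume.restrict (Ico (0 : ℝ) 1))).NeBot := by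
    rw [ae_neBot, Ne, Measure.restrict_eq_zero]
    simp
  obtain ⟨t, ht, h1, h2⟩ := hgood.exists
  refine ⟨(t : ℂ)⁻¹ • U t, ?_, ?_⟩
  · rw [map_smul, h1, smul_smul, inv_mul_cancel₀ (by simpa using ht.ne'), one_smul]
  · rw [map_smul, h2, smul_smul, inv_mul_cancel₀ (by simpa using ht.ne'), one_smul]

variable {P : ℂ → UnitLp E₀ p →L[ℂ] UnitLp E₀ p} {θ : ℝ}

/-- Lebesgue differentiation identifies the orbit with `expOp (P t) x` at almost every t. There the
equation reads BU(t) = e^{tB}x - x, and U(t)/t represents the mean. -/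
lemma ae_exists_mean_mem_domain [CompleteSpace E₀] (hθ : 0 < θ) (hθ' : θ < Real.pi / 2)
    (hP : ∀ z ∈ openSector θ, IsDerivOp ι (z • B) (P z)) (x : E₀) :
    ∀ᵐ t : ℝ, t ∈ Ioo (0 : ℝ) 1 → ∃ w, ι w = meanOp (P t) x ∧
      B w = (t : ℂ)⁻¹ • (expOp (P t) x - x) := by
  have h1 : (1 : ℂ) ∈ openSector θ := by simpa using ofReal_mem_openSector hθ one_pos
  have hP1 := hP 1 h1
  rw [one_smul] at hP1
  obtain ⟨U, hU⟩ := hP1.exists_sol_const x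
  have hray : ∀ t ∈ Ioc (0 : ℝ) 1, (t : ℂ) • meanOp (P t) x =
      ∫ s in (0 : ℝ)..t, P 1 (unitConst E₀ p x) s := by
    intro t ht
    simpa using smul_meanOp_ray hP h1 ht x
  have hint := intervalIntegrable_of_memLp hU.memLp_deriv (a := 0) (b := 1) (by simp) (by simp)
  filter_upwards [(ae_restrict_iff' measurableSet_Ico).1 hU.ae_eq,
    (ae_restrict_iff' measurableSet_Ico).1 hU.equation, hint.ae_hasDerivAt_integral]
    with t ha he hd ht
  have ht' : t ∈ Ico (0 : ℝ) 1 := ⟨ht.1.le, ht.2⟩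
  have htne : (t : ℂ) ≠ 0 := by simpa using ht.1.ne'
  specialize ha ht'
  specialize he ht'
  have hd1 := hd (by rw [uIcc_of_le zero_le_one]; exact ⟨ht.1.le, ht.2.le⟩) 0 (by simp)
  have hd2 := hasDerivAt_ray one_ne_zero ht.1.ne'
    (eventually_isDerivOp hθ hθ' hP (by simpa using ofReal_mem_openSector hθ ht.1)) x
  have heq : (fun s : ℝ => (s : ℂ) • meanOp (P (s * 1)) x) =ᶠ[𝓝 t]
      fun u => ∫ s in (0 : ℝ)..u, P 1 (unitConst E₀ p x) s := by
    filter_upwards [Ioo_mem_nhds ht.1 ht.2] with s hs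
    rw [mul_one]
    exact hray s ⟨hs.1, hs.2.le⟩
  have hval := (hd1.congr_of_eventuallyEq heq).unique hd2
  rw [mul_one] at hval
  rw [hval] at he
  refine ⟨(t : ℂ)⁻¹ • U t, ?_, ?_⟩
  · rw [map_smul, ha, ← hray t ⟨ht.1, ht.2.le⟩, smul_smul, inv_mul_cancel₀ htne, one_smul]
  · rw [map_smul, sub_eq_iff_eq_add.1 he, add_sub_cancel_left]

lemma isHol_of_isDerivOp [CompleteSpace E₀] [CompleteSpace E₁] (hdense : DenseRange ι)
    (hθ : 0 < θ) (hθ' : θ < Real.pi / 2)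
    (hP : ∀ z ∈ openSector θ, IsDerivOp ι (z • B) (P z))
    (hK : ∀ z ∈ openSector θ, ‖z‖ ≤ 1 → ‖P z‖ ≤ K) : IsHol ι B := by
  -- The sector omits 0, where `P` carries no information, so the identity is prescribed there.
  set S : ℂ → E₀ →L[ℂ] E₀ := fun z =>
    if z = 0 then ContinuousLinearMap.id ℂ E₀ else expOp (P z)
  have hS : ∀ z ∈ openSector θ, S z = expOp (P z) := fun z hz => if_neg hz.1
  have hlim := tendsto_expOp_of_denseRange hdense hθ hθ' hP hK
  have hreal : Tendsto (fun t : ℝ => (t : ℂ)) (𝓝[>] 0) (𝓝[openSector θ] 0) := by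
    refine tendsto_nhdsWithin_of_tendsto_nhds_of_eventually_within _ ?_ ?_
    · exact (Complex.continuous_ofReal.tendsto' 0 0 rfl).mono_left nhdsWithin_le_nhds
    · filter_upwards [self_mem_nhdsWithin] with t ht using ofReal_mem_openSector hθ ht
  refine ⟨θ, hθ, hθ'.le, S, ⟨if_pos rfl, ?_, ?_, ?_⟩, ?_⟩
  · intro z hz w hw
    rw [hS z hz, hS w hw, hS _ (add_mem_openSector hθ hθ' hz hw)]
    exact expOp_add hdense hθ hθ' hP hz hw
  · exact (differentiableOn_expOp hθ hθ' hP).congr hS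
  · intro x
    refine (hlim x).1.congr' ?_
    filter_upwards [self_mem_nhdsWithin] with z hz
    rw [hS z hz]
  · intro x y
    constructor
    · intro hxy
      have h1 : (1 : ℂ) ∈ openSector θ := by simpa using ofReal_mem_openSector hθ one_pos
      have hP1 := hP 1 h1
      rw [one_smul] at hP1
      obtain ⟨K', hreg⟩ := hP1.reg
      -- For almost every small t the mean over (0,t) lies in the domain, is close to x, and is
      -- mapped by B to the difference quotient, which is close to y.
      refine hreg.exists_of_approx fun ε hε => ?_
      have e1 := Metric.tendsto_nhds.1 hxy ε hε
      have e2 := Metric.tendsto_nhds.1 ((hlim x).2.comp hreal) ε hε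
      obtain ⟨r, hr, hsub⟩ := mem_nhdsGT_iff_exists_Ioo_subset.1 (e1.and e2)
      obtain ⟨t, ht, htd⟩ := (Measure.dense_of_ae
        (ae_exists_mean_mem_domain hθ hθ' hP x)).exists_mem_open isOpen_Ioo
        (nonempty_Ioo.2 (lt_min hr (zero_lt_one (α := ℝ))))
      obtain ⟨w, hw1, hw2⟩ := ht ⟨htd.1, htd.2.trans_le (min_le_right _ _)⟩
      obtain ⟨d1, d2⟩ := hsub ⟨htd.1, htd.2.trans_le (min_le_left _ _)⟩
      refine ⟨w, ?_, ?_⟩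
      · rw [hw1, ← dist_eq_norm]
        exact d2
      · rw [hw2, ← dist_eq_norm]
        beta_reduce at d1
        rw [hS _ (ofReal_mem_openSector hθ htd.1)] at d1
        rwa [← Complex.ofReal_inv, Complex.coe_smul]
    · rintro ⟨w, rfl, rfl⟩
      refine ((hlim (B w)).2.comp hreal).congr' ?_
      filter_upwards [self_mem_nhdsWithin] with t ht
      have hts := ofReal_mem_openSector hθ (mem_Ioi.1 ht)
      rw [hS _ hts, expOp_of_domain hθ hθ' hP hts, add_sub_cancel_left, Complex.coe_smul,
        smul_smul, inv_mul_cancel₀ (mem_Ioi.1 ht).ne', one_smul]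
      rfl

end Generator

/-! ### Well-posedness on all intervals and sectoriality -/

section Extension

variable {E₀ E₁ : Type*} [NormedAddCommGroup E₀] [NormedSpace ℂ E₀]
  [NormedAddCommGroup E₁] [NormedSpace ℂ E₁]
  {ι : E₁ →L[ℂ] E₀} {p : ℝ} [Fact (1 ≤ ENNReal.ofReal p)]

/-- Double until the length exceeds R, then restrict. The quantifier order matters: K' is chosen
before B, which gives uniformity in A and in z later. -/
lemma ZeroMaxReg.exists_extend (K : NNReal) {T : ℝ} (hT : 0 < T) (R : ℝ) :
    ∃ K' : NNReal, ∀ B : E₁ →L[ℂ] E₀, ZeroMaxReg ι p K T B → ZeroMaxReg ι p K' R B := by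
  have hdouble : ∀ n : ℕ, ∃ K' : NNReal, ∀ B : E₁ →L[ℂ] E₀,
      ZeroMaxReg ι p K T B → ZeroMaxReg ι p K' (2 ^ n * T) B := by
    intro n
    induction n with
    | zero => exact ⟨K, fun B h => by simpa using h⟩
    | succ n ih =>
      obtain ⟨K', hK'⟩ := ih
      refine ⟨4 * K' + 2 * K' ^ 2, fun B h => ?_⟩
      have := (hK' B h).double (by positivity)
      rwa [← two_mul, ← mul_assoc, ← pow_succ'] at this
  obtain ⟨n, hn⟩ := pow_unbounded_of_one_lt (R / T) (one_lt_two)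
  obtain ⟨K', hK'⟩ := hdouble n
  exact ⟨K', fun B h => (hK' B h).restrict ((div_lt_iff₀ hT).1 hn).le⟩

/-- Write zB = B + (z - 1)B and use |z - 1| ≤ |arg z|: a relatively bounded perturbation with C = 0,
so the interval need not be shortened. -/
lemma ZeroMaxReg.smul_of_norm_eq_one [CompleteSpace E₀] {K : NNReal} {T : ℝ} {B : E₁ →L[ℂ] E₀}
    (h : ZeroMaxReg ι p K T B) (hT : 0 ≤ T) {z : ℂ} (hz : ‖z‖ = 1)
    (harg : |z.arg| * (K + 1) ≤ 1 / 2) : ZeroMaxReg ι p (2 * K) T (z • B) := by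
  have hz1 : ‖z - 1‖ ≤ |z.arg| := by
    have h1 : z = Complex.exp (.I * z.arg) := by
      conv_lhs => rw [← Complex.norm_mul_exp_arg_mul_I z, hz]
      rw [Complex.ofReal_one, one_mul, mul_comm]
    have h2 := Real.norm_exp_I_mul_ofReal_sub_one_le (x := z.arg)
    rwa [← h1] at h2
  have h2 := h.add_relBounded hT (A := (z - 1) • B) (δ := |z.arg|) (C := 0) (abs_nonneg _) le_rfl
    (fun u => by
      rw [smul_apply, norm_smul, zero_mul, add_zero]
      gcongr) (by simpa using harg)
  rwa [sub_smul, one_smul, add_sub_cancel] at h2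

lemma ZeroMaxReg.isHol [CompleteSpace E₀] [CompleteSpace E₁] {K : NNReal} {T : ℝ}
    {B : E₁ →L[ℂ] E₀} (h : ZeroMaxReg ι p K T B) (hT : 0 < T) (hdense : DenseRange ι) :
    IsHol ι B := by
  -- The second bound yields |arg z|(K + 1) ≤ 1/2, as required for rotating B.
  set θ : ℝ := min (Real.pi / 4) (1 / (2 * (K + 1)))
  have hθ : 0 < θ := lt_min (by positivity) (by positivity)
  have hθ' : θ < Real.pi / 2 :=
    (min_le_left _ _).trans_lt (by linarith [Real.pi_pos])
  have hreg : ∀ R : ℝ, ∃ K' : NNReal, ∀ z ∈ openSector θ, ‖z‖ ≤ R → ZeroMaxReg ι p K' 1 (z • B) := by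
    intro R
    obtain ⟨K', hK'⟩ := ZeroMaxReg.exists_extend (ι := ι) (p := p) (2 * K) hT R
    refine ⟨K', fun z hz hzR => ?_⟩
    have hz0 : 0 < ‖z‖ := norm_pos_iff.2 hz.1
    set e : ℂ := (‖z‖⁻¹ : ℝ) * z
    have he : ‖e‖ = 1 := by
      rw [norm_mul, Complex.norm_real, norm_inv, norm_norm, inv_mul_cancel₀ hz0.ne']
    have harg : e.arg = z.arg := Complex.arg_real_mul z (inv_pos.2 hz0)
    have h1 : ZeroMaxReg ι p (2 * K) T (e • B) := by
      refine h.smul_of_norm_eq_one hT.le he ?_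
      rw [harg]
      have : |z.arg| ≤ 1 / (2 * (K + 1)) := hz.2.le.trans (min_le_right _ _)
      calc |z.arg| * (K + 1) ≤ 1 / (2 * (K + 1)) * (K + 1) := by gcongr
        _ = 1 / 2 := by field_simp
    -- Well-posedness of the rotated operator on (0,|z|) is well-posedness of zB on (0,1).
    have h2 := ((hK' _ h1).restrict hzR).rescale hz0
    rw [div_self hz0.ne', smul_smul] at h2
    have h3 : (‖z‖ : ℂ) * e = z := by
      rw [← mul_assoc, ← Complex.ofReal_mul, mul_inv_cancel₀ hz0.ne', Complex.ofReal_one, one_mul]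
    rwa [h3] at h2
  obtain ⟨K₁, hK₁⟩ := hreg 1
  have hP : ∀ z : ℂ, ∃ P : UnitLp E₀ p →L[ℂ] UnitLp E₀ p, z ∈ openSector θ →
      IsDerivOp ι (z • B) P ∧ (‖z‖ ≤ 1 → ‖P‖ ≤ K₁) := by
    intro z
    by_cases hz : z ∈ openSector θ
    · by_cases hz1 : ‖z‖ ≤ 1
      · obtain ⟨P, hP1, hP2⟩ := (hK₁ z hz hz1).exists_isDerivOp
        exact ⟨P, fun _ => ⟨hP2, fun _ => hP1⟩⟩
      · obtain ⟨K', hK'⟩ := hreg ‖z‖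
        obtain ⟨P, -, hP2⟩ := (hK' z hz le_rfl).exists_isDerivOp
        exact ⟨P, fun _ => ⟨hP2, fun h => (hz1 h).elim⟩⟩
    · exact ⟨0, fun h => (hz h).elim⟩
  choose P hP using hP
  exact isHol_of_isDerivOp hdense hθ hθ' (fun z hz => (hP z hz).1) fun z hz => (hP z hz).2

end Extension

/-! ### Nonzero initial values -/

section InitialValue

variable {E₀ E₁ : Type*} [NormedAddCommGroup E₀] [NormedSpace ℂ E₀]
  [NormedAddCommGroup E₁] [NormedSpace ℂ E₁]
  {ι : E₁ →L[ℂ] E₀} {p T : ℝ} {B : E₁ →L[ℂ] E₀} {K : NNReal}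
  {g h : ℝ → E₀} {u₀ : E₀} {u w : ℝ → E₀} {U W Z : ℝ → E₁} {u' w' f : ℝ → E₀}

lemma lintegral_enorm_rpow_eq {F : Type*} [NormedAddCommGroup F] (hp : 0 < p) (φ : ℝ → F)
    (μ : Measure ℝ) : ∫⁻ t, ‖φ t‖ₑ ^ p ∂μ = eLpNorm φ (ENNReal.ofReal p) μ ^ p := by
  rw [eLpNorm_eq_lintegral_rpow_enorm_toReal (by simpa using hp) (by simp),
    ENNReal.toReal_ofReal hp.le, ← ENNReal.rpow_mul, one_div, inv_mul_cancel₀ hp.ne',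
    ENNReal.rpow_one]

lemma IsAbstractSobolev.isStrictSolution (hw : IsAbstractSobolev ι p (Ici 0) w W w') (T : ℝ)
    (B : E₁ →L[ℂ] E₀) :
    IsStrictSolution ι p T B (fun t => w' t - B (W t)) (w 0) w W w' where
  sobolev :=
    { memLp := hw.memLp.mono_measure (Measure.restrict_mono_set _ Ico_subset_Ici_self)
      ae_eq := ae_restrict_of_ae_restrict_of_subset Ico_subset_Ici_self hw.ae_eq
      memLp_deriv := hw.memLp_deriv.mono_measure (Measure.restrict_mono_set _ Ico_subset_Ici_self)
      sub_eq_integral := fun t₁ h₁ t₂ h₂ h =>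
        hw.sub_eq_integral t₁ (Ico_subset_Ici_self h₁) t₂ (Ico_subset_Ici_self h₂) h }
  initial := rfl
  equation := .of_forall fun _ => rfl

variable [Fact (1 ≤ ENNReal.ofReal p)]

lemma IsStrictSolution.sub_isZeroSolution (hu : IsStrictSolution ι p T B g u₀ u U u')
    (hw : IsStrictSolution ι p T B h u₀ w W w') :
    IsZeroSolution ι p T B (g - h) (U - W) (u' - w') where
  memLp := hu.sobolev.memLp.sub hw.sobolev.memLp
  memLp_deriv := hu.sobolev.memLp_deriv.sub hw.sobolev.memLp_deriv
  ae_eq := by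
    filter_upwards [hu.sobolev.ae_eq, hw.sobolev.ae_eq, ae_restrict_mem measurableSet_Ico]
      with t h1 h2 ht
    have hT : 0 < T := ht.1.trans_lt ht.2
    have ht' : t ∈ Icc 0 T := ⟨ht.1, ht.2.le⟩
    have e1 := hu.sobolev.sub_eq_integral 0 ⟨le_rfl, hT⟩ t ht ht.1
    have e2 := hw.sobolev.sub_eq_integral 0 ⟨le_rfl, hT⟩ t ht ht.1
    simp only [Pi.sub_apply, map_sub]
    rw [intervalIntegral.integral_sub
      (intervalIntegrable_of_memLp hu.sobolev.memLp_deriv ⟨le_rfl, hT.le⟩ ht')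
      (intervalIntegrable_of_memLp hw.sobolev.memLp_deriv ⟨le_rfl, hT.le⟩ ht'), ← e1, ← e2,
      hu.initial, hw.initial, h1, h2]
    abel
  equation := by
    filter_upwards [hu.equation, hw.equation] with t h1 h2
    simp only [Pi.sub_apply, map_sub, ← h1, ← h2]
    abel

lemma IsStrictSolution.add_isZeroSolution (hw : IsStrictSolution ι p T B h u₀ w W w')
    (hz : IsZeroSolution ι p T B (g - h) Z f) :
    IsStrictSolution ι p T B g u₀ (fun t => w t + ∫ s in (0 : ℝ)..t, f s) (W + Z) (w' + f) where
  sobolev :=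
    { memLp := hw.sobolev.memLp.add hz.memLp
      memLp_deriv := hw.sobolev.memLp_deriv.add hz.memLp_deriv
      ae_eq := by
        filter_upwards [hw.sobolev.ae_eq, hz.ae_eq] with t h1 h2
        rw [Pi.add_apply, map_add, h1, h2]
      sub_eq_integral := by
        intro t₁ h₁ t₂ h₂ hle
        have hT : 0 ≤ T := h₁.1.trans h₁.2.le
        have h0 : (0 : ℝ) ∈ Icc 0 T := ⟨le_rfl, hT⟩
        have h₁' : t₁ ∈ Icc 0 T := ⟨h₁.1, h₁.2.le⟩
        have h₂' : t₂ ∈ Icc 0 T := ⟨h₂.1, h₂.2.le⟩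
        have i := fun {a b : ℝ} => intervalIntegrable_of_memLp hz.memLp_deriv (a := a) (b := b)
        simp only [Pi.add_apply]
        rw [intervalIntegral.integral_add
          (intervalIntegrable_of_memLp hw.sobolev.memLp_deriv h₁' h₂') (i h₁' h₂'),
          ← hw.sobolev.sub_eq_integral t₁ h₁ t₂ h₂ hle,
          ← intervalIntegral.integral_interval_sub_left (i h0 h₂') (i h0 h₁')]
        abel }
  initial := by simp [hw.initial]
  equation := by
    filter_upwards [hw.equation, hz.equation] with t h1 h2
    rw [Pi.sub_apply, ← h1, eq_comm, sub_eq_iff_eq_add] at h2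
    simp only [Pi.add_apply, map_add, h2]
    abel

lemma isStrictSolution_zero (ι : E₁ →L[ℂ] E₀) (p T : ℝ) (B : E₁ →L[ℂ] E₀) :
    IsStrictSolution ι p T B 0 0 0 0 0 where
  sobolev := ⟨MemLp.zero, by simp, MemLp.zero, by simp⟩
  initial := rfl
  equation := by simp

lemma zero_mem_traceSpace (ι : E₁ →L[ℂ] E₀) (p : ℝ) : (0 : E₀) ∈ traceSpace ι p :=
  ⟨0, 0, 0, ⟨MemLp.zero, by simp, MemLp.zero, by simp⟩, rfl⟩

lemma traceNorm_zero (ι : E₁ →L[ℂ] E₀) (p : ℝ) : traceNorm ι p (0 : E₀) = 0 := by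
  refine le_antisymm ?_ zero_le
  refine (iInf_le_of_le 0 <| iInf_le_of_le 0 <| iInf_le_of_le 0 <|
    iInf_le_of_le ⟨⟨MemLp.zero, by simp, MemLp.zero, by simp⟩, rfl⟩ ?_)
  simp

lemma IsMaxReg.exists_zeroMaxReg (hp : 0 < p) (hB : IsMaxReg ι p T B) :
    ∃ K : NNReal, ZeroMaxReg ι p K T B := by
  obtain ⟨M, hM, hest⟩ := hB.estimate
  refine ⟨M.toNNReal ^ p⁻¹, fun g hg => ?_, fun g U f hs => ?_⟩
  · obtain ⟨u, U, u', hu, -⟩ := hB.existsUnique 0 (zero_mem_traceSpace ι p) g hg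
    exact ⟨U, u', by simpa using hu.sub_isZeroSolution (isStrictSolution_zero ι p T B)⟩
  · have hsol := (isStrictSolution_zero ι p T B).add_isZeroSolution (g := g) (by simpa using hs)
    have h1 := hest 0 (zero_mem_traceSpace ι p) g hs.memLp_data _ _ _ hsol
    rw [traceNorm_zero, ENNReal.zero_rpow_of_pos hp, zero_add, zero_add,
      lintegral_enorm_rpow_eq hp, lintegral_enorm_rpow_eq hp] at h1
    have h2 := le_self_add.trans h1
    rw [zero_add, lintegral_enorm_rpow_eq hp] at h2
    rw [← ENNReal.rpow_le_rpow_iff hp, ENNReal.mul_rpow_of_nonneg _ _ hp.le,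
      ← ENNReal.coe_rpow_of_nonneg _ hp.le, ← NNReal.rpow_mul, inv_mul_cancel₀ hp.ne',
      NNReal.rpow_one]
    exact h2

/-- Subtracting a function w with w(0) = u₀ leaves a problem with zero initial value. Uniqueness
holds at every point because solutions are integrals of their derivatives. -/
lemma ZeroMaxReg.existsUnique_isStrictSolution (hreg : ZeroMaxReg ι p K T B)
    (hu₀ : u₀ ∈ traceSpace ι p)
    (hg : MemLp g (ENNReal.ofReal p) (volume.restrict (Ico 0 T))) :
    ∃ (u : ℝ → E₀) (U : ℝ → E₁) (u' : ℝ → E₀), IsStrictSolution ι p T B g u₀ u U u' ∧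
      ∀ (w : ℝ → E₀) (W : ℝ → E₁) (w' : ℝ → E₀), IsStrictSolution ι p T B g u₀ w W w' →
        EqOn w u (Ico 0 T) := by
  obtain ⟨w, W, w', hw, rfl⟩ := hu₀
  have hws := hw.isStrictSolution T B
  obtain ⟨Z, f, hz⟩ := hreg.exists_sol (g - fun t => w' t - B (W t))
    (hg.sub (hws.sobolev.memLp_deriv.sub (B.comp_memLp' hws.sobolev.memLp)))
  have hsol := hws.add_isZeroSolution hz
  refine ⟨_, _, _, hsol, fun v V v' hv t ht => ?_⟩
  have h0 := hreg.ae_eq_zero (hv.sub_isZeroSolution hsol) (by simp)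
  have h1 : v' =ᵐ[volume.restrict (Ico 0 T)] w' + f := by
    filter_upwards [h0] with t ht
    exact sub_eq_zero.1 ht
  have hT : 0 < T := ht.1.trans_lt ht.2
  have e1 := hv.sobolev.sub_eq_integral 0 ⟨le_rfl, hT⟩ t ht ht.1
  have e2 := hsol.sobolev.sub_eq_integral 0 ⟨le_rfl, hT⟩ t ht ht.1
  rw [intervalIntegral_congr_of_ae h1 ⟨le_rfl, hT.le⟩ ⟨ht.1, ht.2.le⟩, ← e2, hv.initial,
    hsol.initial] at e1
  exact sub_left_inj.1 e1

/-- For every w with w(0) = u₀, the difference u - w is a zero solution with data g - (w' - Bw).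
Estimating it and taking the infimum over w brings in the trace norm. -/
lemma ZeroMaxReg.eLpNorm_deriv_le (hreg : ZeroMaxReg ι p K T B) {b : NNReal} (hb : ‖B‖ ≤ b)
    (hg : MemLp g (ENNReal.ofReal p) (volume.restrict (Ico 0 T)))
    (hu : IsStrictSolution ι p T B g u₀ u U u') :
    eLpNorm u' (ENNReal.ofReal p) (volume.restrict (Ico 0 T)) ≤
      ((1 + K * (1 + b) : NNReal) : ℝ≥0∞) * (traceNorm ι p u₀ +
        eLpNorm g (ENNReal.ofReal p) (volume.restrict (Ico 0 T))) := by
  have hq : 1 ≤ ENNReal.ofReal p := Fact.out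
  set D : NNReal := 1 + K * (1 + b) with hD
  set X := eLpNorm u' (ENNReal.ofReal p) (volume.restrict (Ico 0 T))
  set G := eLpNorm g (ENNReal.ofReal p) (volume.restrict (Ico 0 T))
  have hD0 : (D : ℝ≥0∞) ≠ 0 := by
    rw [ENNReal.coe_ne_zero]
    positivity
  -- The estimate is solved for the trace norm so that it can be proved for each competitor in the
  -- infimum.
  have key : (X - D * G) / D ≤ traceNorm ι p u₀ := by
    refine le_iInf fun w => le_iInf fun W => le_iInf fun w' => le_iInf fun ⟨hw, hw0⟩ => ?_
    subst hw0
    have hws := hw.isStrictSolution T B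
    have hz := hu.sub_isZeroSolution hws
    have b1 := hreg.bound _ _ _ hz
    set N := eLpNorm W (ENNReal.ofReal p) (volume.restrict (Ici 0)) +
      eLpNorm w' (ENNReal.ofReal p) (volume.restrict (Ici 0))
    have hW : eLpNorm W (ENNReal.ofReal p) (volume.restrict (Ico 0 T)) ≤ N :=
      (eLpNorm_mono_measure _ (Measure.restrict_mono_set _ Ico_subset_Ici_self)).trans le_self_add
    have hw' : eLpNorm w' (ENNReal.ofReal p) (volume.restrict (Ico 0 T)) ≤ N :=
      (eLpNorm_mono_measure _ (Measure.restrict_mono_set _ Ico_subset_Ici_self)).trans le_add_self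
    have hBW : eLpNorm (fun t => B (W t)) (ENNReal.ofReal p) (volume.restrict (Ico 0 T)) ≤
        b * N := by
      refine (eLpNorm_le_nnreal_smul_eLpNorm_of_ae_le_mul (g := W) (c := b)
        (.of_forall fun t => ?_) _).trans ?_
      · exact B.le_of_opNorm_le hb _
      · rw [ENNReal.smul_def, smul_eq_mul]
        gcongr
    have hBWm := B.comp_memLp' hws.sobolev.memLp
    have b2 : eLpNorm (g - fun t => w' t - B (W t)) (ENNReal.ofReal p)
        (volume.restrict (Ico 0 T)) ≤ G + (N + b * N) := by
      refine (eLpNorm_sub_le hg.1 (hws.sobolev.memLp_deriv.sub hBWm).1 hq).trans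
        (add_le_add le_rfl ?_)
      exact (eLpNorm_sub_le hws.sobolev.memLp_deriv.1 hBWm.1 hq).trans (add_le_add hw' hBW)
    have b3 : X ≤ K * (G + (N + b * N)) + N := by
      have e : u' = (u' - w') + w' := by simp
      calc X = eLpNorm ((u' - w') + w') (ENNReal.ofReal p) (volume.restrict (Ico 0 T)) := by
            rw [← e]
        _ ≤ _ := eLpNorm_add_le hz.memLp_deriv.1 hws.sobolev.memLp_deriv.1 hq
        _ ≤ _ := add_le_add (b1.trans (mul_le_mul' le_rfl b2)) hw'
    have b4 : X ≤ N * D + D * G := by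
      refine b3.trans ?_
      have e : N * D + D * G = K * (G + (N + b * N)) + N + (1 + K * b) * G := by
        rw [hD]
        push_cast
        ring
      rw [e]
      exact le_self_add
    exact ENNReal.div_le_of_le_mul (tsub_le_iff_right.2 b4)
  have h1 := (ENNReal.div_le_iff_le_mul (Or.inl hD0) (Or.inl (by simp))).1 key
  rw [tsub_le_iff_right] at h1
  refine h1.trans_eq ?_
  ring

lemma ZeroMaxReg.maxRegEstimate (hp : 1 ≤ p) (hreg : ZeroMaxReg ι p K T B) {b : NNReal}
    (hb : ‖B‖ ≤ b) : MaxRegEstimate ι p T B ((2 * (2 + K * (1 + b))) ^ p) := by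
  intro u₀ _ g hg u U u' hu
  have hp0 : 0 < p := by linarith
  have hq : 1 ≤ ENNReal.ofReal p := Fact.out
  have h1 := hreg.eLpNorm_deriv_le hb hg hu
  rw [lintegral_enorm_rpow_eq hp0, lintegral_enorm_rpow_eq hp0, lintegral_enorm_rpow_eq hp0]
  set N := traceNorm ι p u₀
  set G := eLpNorm g (ENNReal.ofReal p) (volume.restrict (Ico 0 T))
  -- One more than the constant for u', since Bu = u' - g; this D serves both terms.
  set D : NNReal := 2 + K * (1 + b) with hD
  have h1' : eLpNorm u' (ENNReal.ofReal p) (volume.restrict (Ico 0 T)) ≤ D * (N + G) := by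
    refine h1.trans (mul_le_mul' ?_ le_rfl)
    norm_cast
    rw [hD]
    gcongr
    exact one_le_two
  have h2 : eLpNorm (fun t => B (U t)) (ENNReal.ofReal p) (volume.restrict (Ico 0 T)) ≤
      D * (N + G) := by
    have e : (fun t => B (U t)) =ᵐ[volume.restrict (Ico 0 T)] u' - g := by
      filter_upwards [hu.equation] with t ht
      rw [Pi.sub_apply, ← ht]
      abel
    rw [eLpNorm_congr_ae e]
    calc _ ≤ _ := eLpNorm_sub_le hu.sobolev.memLp_deriv.1 hg.1 hq
      _ ≤ ((1 + K * (1 + b) : NNReal) : ℝ≥0∞) * (N + G) + (N + G) :=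
        add_le_add h1 le_add_self
      _ = D * (N + G) := by
        rw [hD]
        push_cast
        ring
  have h3 : (D * (N + G)) ^ p ≤ (D : ℝ≥0∞) ^ p * (2 ^ (p - 1) * (N ^ p + G ^ p)) := by
    rw [ENNReal.mul_rpow_of_nonneg _ _ hp0.le]
    gcongr
    exact ENNReal.rpow_add_le_mul_rpow_add_rpow _ _ hp
  have e2 : (2 : ℝ≥0∞) * 2 ^ (p - 1) = 2 ^ p := by
    nth_rw 1 [← ENNReal.rpow_one 2]
    rw [← ENNReal.rpow_add _ _ (by simp) (by simp)]
    congr 1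
    ring
  have e3 : ENNReal.ofReal ((2 * (2 + K * (1 + b))) ^ p) = 2 ^ p * (D : ℝ≥0∞) ^ p := by
    rw [← ENNReal.ofReal_rpow_of_nonneg (by positivity) hp0.le,
      ENNReal.ofReal_mul zero_le_two, ENNReal.mul_rpow_of_nonneg _ _ hp0.le]
    congr 2
    · simp
    · rw [← ENNReal.ofReal_coe_nnreal, hD]
      push_cast
      rfl
  calc _ ≤ (D * (N + G)) ^ p + (D * (N + G)) ^ p := by gcongr
    _ ≤ (D : ℝ≥0∞) ^ p * (2 ^ (p - 1) * (N ^ p + G ^ p)) +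
        (D : ℝ≥0∞) ^ p * (2 ^ (p - 1) * (N ^ p + G ^ p)) := add_le_add h3 h3
    _ = 2 * 2 ^ (p - 1) * (D : ℝ≥0∞) ^ p * (N ^ p + G ^ p) := by ring
    _ = _ := by rw [e2, e3]

end InitialValue

theorem lemma5p2 {E₀ E₁ : Type*}
    [NormedAddCommGroup E₀] [NormedSpace ℂ E₀] [CompleteSpace E₀]
    [NormedAddCommGroup E₁] [NormedSpace ℂ E₁] [CompleteSpace E₁]
    (ι : E₁ →L[ℂ] E₀) (hι : Function.Injective ι) (hdense : DenseRange ι)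
    (p : ℝ) (hp : 1 < p) (T₀ : ℝ) (hT₀ : 0 < T₀)
    (B : E₁ →L[ℂ] E₀) (hB : IsMaxReg ι p T₀ B) :
    ∃ δ₀ : ℝ, 0 < δ₀ ∧ δ₀ < 1 ∧
      ∀ δ : ℝ, 0 < δ → δ ≤ δ₀ → ∀ C : ℝ, 0 ≤ C → ∀ T : ℝ, 0 < T →
        ∃ M : ℝ, 0 < M ∧ ∀ A : E₁ →L[ℂ] E₀,
          (∀ u : E₁, ‖A u‖ ≤ δ * ‖B u‖ + C * ‖ι u‖) →
            IsMaxReg ι p T (B + A) ∧ MaxRegEstimate ι p T (B + A) M := by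
  have hp0 : 0 < p := by linarith
  have : Fact (1 ≤ ENNReal.ofReal p) := ⟨ENNReal.one_le_ofReal.2 hp.le⟩
  obtain ⟨K, hK⟩ := hB.exists_zeroMaxReg hp0
  have hK1 : (0 : ℝ) < K + 1 := by positivity
  -- The smallness budget 1/2 is split evenly: δ₀ secures δ(K + 1) ≤ 1/4 and `T₁` secures C T₁ K ≤
  -- 1/4.
  refine ⟨1 / (4 * (K + 1)), by positivity, ?_, fun δ hδ hδ₀ C hC T hT => ?_⟩
  · rw [div_lt_one (by positivity)]
    linarith [K.coe_nonneg]
  set T₁ : ℝ := min T₀ (1 / (4 * (C * K + 1)))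
  have hT₁ : 0 < T₁ := lt_min hT₀ (by positivity)
  have hδK : δ * (K + 1) ≤ 1 / 4 :=
    calc δ * (K + 1) ≤ 1 / (4 * (K + 1)) * (K + 1) := by gcongr
      _ = 1 / 4 := by field_simp
  have hCT : C * (T₁ * K) ≤ 1 / 4 :=
    calc C * (T₁ * K) = T₁ * (C * K) := by ring
      _ ≤ 1 / (4 * (C * K + 1)) * (C * K + 1) := by
        gcongr
        · exact min_le_right _ _
        · linarith
      _ = 1 / 4 := by
        have : C * K + 1 ≠ 0 := by positivity
        field_simp
  obtain ⟨K', hK'⟩ := ZeroMaxReg.exists_extend (ι := ι) (p := p) (2 * K) hT₁ T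
  -- A bound for ‖B + A‖ that is the same for all admissible A.
  set b : NNReal := ⟨‖B‖ + (δ * ‖B‖ + C * ‖ι‖), by positivity⟩
  refine ⟨(2 * (2 + K' * (1 + b))) ^ p, by positivity, fun A hA => ?_⟩
  have hreg : ZeroMaxReg ι p K' T (B + A) :=
    hK' _ ((hK.restrict (min_le_left _ _)).add_relBounded hT₁.le hδ.le hC hA (by linarith))
  have hAnorm : ‖A‖ ≤ δ * ‖B‖ + C * ‖ι‖ :=
    A.opNorm_le_bound (by positivity) fun u => (hA u).trans <| by
      have h1 := B.le_opNorm u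
      have h2 := ι.le_opNorm u
      calc δ * ‖B u‖ + C * ‖ι u‖ ≤ δ * (‖B‖ * ‖u‖) + C * (‖ι‖ * ‖u‖) := by gcongr
        _ = (δ * ‖B‖ + C * ‖ι‖) * ‖u‖ := by ring
  have hb : ‖B + A‖ ≤ b := (norm_add_le B A).trans (by
    change _ ≤ ‖B‖ + (δ * ‖B‖ + C * ‖ι‖)
    gcongr)
  have hest := hreg.maxRegEstimate hp.le hb
  exact ⟨⟨hreg.isHol hT hdense, fun u₀ hu₀ g hg => hreg.existsUnique_isStrictSolution hu₀ hg,
    _, by positivity, hest⟩, hest⟩
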